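/- For $\nu>0$ and $l>0$ let $$k_{\nu,l}(x,x')=\frac{2^{1-\nu}}{\Gamma(\nu)}\Big(\frac{\sqrt{2\nu}\,|x-x'|}{l}\Big)^{\nu}K_\nu\Big(\frac{\sqrt{2\nu}\,|x-x'|}{l}\Big)$$ (with $k_{\nu,l}(x,x)=1$, and $K_\nu$ the modified Bessel function of the second kind) be the Matérn-$\nu$ kernel on $[0,1]$ with length-scale $l$, and let $\mathcal H_{\nu,l}(B)$ be the closed ball of radius $B$ in its reproducing kernel Hilbert space on $[0,1]$. Bandit problem: given a reward function $f:[0,1]\to\mathbb R$, in each round $t=1,\dots,T$ a (possibly randomised) algorithm, which does not know $f$ and may know $T$, chooses $x_t\in[0,1]$ from the past actions and rewards and receives $y_t=f(x_t)+\varepsilon_t$, where the noises $\varepsilon_t$ are i.i.d. (with $\varepsilon_t$ independent of the past and of $x_t$) with a law $N$ in a given set $\mathcal N$ of zero-mean probability laws on $\mathbb R$ that are $\tfrac14$-sub-Gaussian, i.e. $\mathbb E\,e^{s\varepsilon}\le e^{s^2/8}$ for all $s\in\mathbb R$; the set $\mathcal N$ contains the Gaussian law $\mathcal N(0,\tfrac14)$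 (for example, $\mathcal N$ consists of this law only, or of all $\tfrac14$-sub-Gaussian laws). The expected regret is $\mathbb E[R_T]=\mathbb E\sum_{t=1}^T\big(\max f-f(x_t)\big)$. Write $\mathcal R_T(F)=\sup_{f\in F,\,N\in\mathcal N}\mathbb E[R_T]$. As $T\to\infty$, $\tilde O$ and $\tilde\Omega$ denote upper and lower bounds up to positive constants and powers of $\log T$. Statement. Let $0<\nu_1<\nu_2$ be real numbers with $\nu_1+\tfrac12,\nu_2+\tfrac12\in\mathbb N$, and let $l_1,l_2>0$. There exist $B_1,B_2>0$ such that, for every such $\mathcal N$, every algorithm with $$\mathcal R_T(\mathcal H_{\nu_2,l_2}(B_2))=\tilde O\Big(T^{\frac{\nu_2+1}{2\nu_2+1}}\Big)$$ satisfies $$\mathcal R_T(\mathcal H_{\nu_1,l_1}(B_1))=\tilde\Omega\Big(T^{\frac{\nu_1\nu_2+2\nu_2+1}{(\nu_1+1)(2\nu_2+1)}}\Big).$$ Moreover $\frac{\nu_1+1}{2\nu_1+1}<\frac{\nu_1\nu_2+2\nu_2+1}{(\nu_1+1)(2\nu_2+1)}$, so that the regret of such an algorithm on $\mathcal H_{\nu_1,l_1}(B_1)$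 is not $\tilde O\big(T^{\frac{\nu_1+1}{2\nu_1+1}}\big)$, the minimax rate for $\nu_1$. -/

import Mathlib

open MeasureTheory ProbabilityTheory Filter
open scoped ENNReal

noncomputable section

/-- The modified Bessel function of the second kind `K_ν`, at real `z > 0`, through the classical
integral `K_ν(z) = ∫₀^∞ exp (-z cosh t) cosh (ν t) dt`. It is only used at `z > 0`. -/
def besselK (ν z : ℝ) : ℝ :=
  ∫ t in Set.Ioi (0 : ℝ), Real.exp (-z * Real.cosh t) * Real.cosh (ν * t)

/-- The Matérn-`ν` kernel with length-scale `l` in dimension one. On the diagonal it takes the value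
`1`, the limit of the formula as the distance tends to `0`. -/
def maternKernel (ν l x x' : ℝ) : ℝ :=
  if x = x' then 1
  else
    2 ^ (1 - ν) / Real.Gamma ν * (√(2 * ν) * |x - x'| / l) ^ ν *
      besselK ν (√(2 * ν) * |x - x'| / l)

/-- The closed ball of radius `B` in the reproducing kernel Hilbert space of a real kernel `k` on
`X`: the functions that are realised by an element of norm at most `B` of a Hilbert space of
functions on `X` with reproducing kernel `k`. This Hilbert space is unique up to an isometry that
preserves the functions. Its elements are continuous functions when `k` is continuous, hence the
ball is given as a set of continuous functions. -/
def rkhsBall {X : Type} [TopologicalSpace X] (k : X → X → ℝ) (B : ℝ) : Set C(X, ℝ) :=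
  {f | ∃ (H : Type) (_ : NormedAddCommGroup H) (_ : InnerProductSpace ℝ H) (_ : CompleteSpace H)
      (_ : RKHS ℝ H X ℝ),
      (∀ x x' : X, RKHS.kernel H x x' (1 : ℝ) = k x x') ∧
        ∃ g : H, (⇑g : X → ℝ) = ⇑f ∧ ‖g‖ ≤ B}

/-- The ball of radius `B` in the RKHS, on the domain `[0, 1]`, of the Matérn-`ν` kernel with
length-scale `l`. -/
def maternBall (ν l B : ℝ) : Set C(unitInterval, ℝ) :=
  rkhsBall (fun x x' : unitInterval => maternKernel ν l x x') B

/-- What the learner has seen after `t` rounds: the chosen actions in `[0, 1]` with the rewards. -/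
abbrev History (t : ℕ) : Type := Fin t → unitInterval × ℝ

/-- A (possibly randomised) policy: the conditional law of the next action given the past. It has
no access to the reward function or to the function class. -/
structure Policy where
  /-- the law of the action of round `t` (rounds numbered from `0`), given the previous rounds -/
  next : (t : ℕ) → Kernel (History t) unitInterval
  isMarkov : ∀ t, IsMarkovKernel (next t)

/-- The joint law of the actions and rewards of the first `t` rounds, when the policy `π` plays
against the reward function `f` with independent noises of law `N`: the action `x` is drawn from
the policy, a noise `e` is drawn independently of everything so far, and the reward is `f x + e`. -/
def historyLaw (N : Measure ℝ) (f : C(unitInterval, ℝ)) (π : Policy) :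
    (t : ℕ) → Measure (History t)
  | 0 => Measure.dirac Fin.elim0
  | t + 1 =>
    ((historyLaw N f π t ⊗ₘ π.next t).prod N).map
      fun p => (Fin.snoc p.1.1 (p.1.2, f p.1.2 + p.2) : History (t + 1))

/-- The expected cumulative pseudo-regret after `T` rounds. All summands are nonnegative, and the
supremum of `f` is attained, because `f` is continuous on `[0, 1]`. -/
def expectedRegret (N : Measure ℝ) (f : C(unitInterval, ℝ)) (π : Policy) (T : ℕ) : ℝ≥0∞ :=
  ∫⁻ h, ∑ t : Fin T, ENNReal.ofReal ((⨆ x, f x) - f (h t).1) ∂(historyLaw N f π T)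

/-- A bandit algorithm: it may take the horizon `T` as an input. -/
abbrev Algorithm : Type := ℕ → Policy

/-- The worst-case expected regret at horizon `T`, over the reward functions in `F` and over the
noise laws in `𝒩`. -/
def worstRegret (𝒩 : Set (Measure ℝ)) (F : Set C(unitInterval, ℝ)) (A : Algorithm) (T : ℕ) :
    ℝ≥0∞ :=
  ⨆ f ∈ F, ⨆ N ∈ 𝒩, expectedRegret N f (A T) T

/-- `N` is a probability law that is (zero-mean and) sub-Gaussian with variance proxy `1 / 4`. -/
def IsQuarterSubgaussian (N : Measure ℝ) : Prop :=
  IsProbabilityMeasure N ∧ HasSubgaussianMGF id (1 / 4) N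

/-- `g T = Õ(T ^ a)` as `T → ∞`: an upper bound up to a constant and a power of `log T`. -/
def IsTildeO (g : ℕ → ℝ≥0∞) (a : ℝ) : Prop :=
  ∃ (C : ℝ) (k : ℕ), ∀ᶠ T : ℕ in atTop,
    g T ≤ ENNReal.ofReal (C * (T : ℝ) ^ a * Real.log T ^ k)

/-- `g T = Ω̃(T ^ a)` as `T → ∞`: a lower bound up to a positive constant and a power of `log T`. -/
def IsTildeOmega (g : ℕ → ℝ≥0∞) (a : ℝ) : Prop :=
  ∃ (c : ℝ) (k : ℕ), 0 < c ∧ ∀ᶠ T : ℕ in atTop,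
    ENNReal.ofReal (c * (T : ℝ) ^ a / Real.log T ^ k) ≤ g T

end

/-!
An algorithm with low regret on the smooth class cannot explore enough for the rough class.

Take a base reward function `f₀` with a wide bump of height `ρ` in the left half of `[0, 1]`, and
cut the right half into `K` bins. Perturb `f₀` by a spike of height about `2 ρ` that fills one bin. The
spike of width `1 / K` has norm of order `ρ K ^ ν₁` in the RKHS of the Matérn-`ν₁` kernel, so that
`ρ` of order `K ^ (-ν₁)` keeps all perturbations in the rough ball, while `f₀` lies in the smooth
ball. Every action in the right half costs at least `ρ` under `f₀`. If the regret on the smooth ball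
is at most `r`, some bin is visited at most `r / (ρ K)` times in the mean, and if this is a small
multiple of `ρ ^ (-2)`, the visits do not reveal the spike in that bin: under the perturbed function
the algorithm still plays outside the bin at least half of the time with a probability bounded
below, and pays `ρ` each time. The balance `r ρ ≈ K`, `ρ ≈ K ^ (-ν₁)` gives
`ρ ≈ r ^ (-ν₁ / (ν₁ + 1))`, and the regret `ρ T` is the claimed one. All balls may have radius one.

The statistical part is `exists_expectedRegret_ge`. It compares the history laws of two reward
functions by a likelihood ratio (`lintegral_historyLaw_eq`); the estimate `exp_mul_historyLaw_le`
uses the ratio of the reflected reward function `2 f - f'` as a substitute for the inverse ratio.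

The analytic part is the membership of the reward functions in the RKHS balls. For
`ν = n + 1 / 2` the Matérn kernel is the autocorrelation of the normalised filter `u ^ n exp (-a u)`,
by an integral representation of `K_ν` (`sinhIntegral_eq_besselK`). Hence a function is in the ball of
radius `B` if it is the output of the filter for an `L²` input of norm at most `B`
(`mem_maternBall_of_integral`), and Taylor's formula with integral remainder inverts the filter (`mem_maternBall_of_contDiff`).
-/

noncomputable section

/-! ### Bandit histories and change of measure -/

lemma measurable_historySnoc (f : C(unitInterval, ℝ)) (t : ℕ) :
    Measurable fun p : (History t × unitInterval) × ℝ =>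
      (Fin.snoc p.1.1 (p.1.2, f p.1.2 + p.2) : History (t + 1)) := by
  refine measurable_pi_iff.2 fun i => ?_
  refine Fin.lastCases ?_ (fun j => ?_) i
  · simp only [Fin.snoc_last]; fun_prop
  · simp only [Fin.snoc_castSucc]; fun_prop

lemma isProbabilityMeasure_historyLaw (N : Measure ℝ) [IsProbabilityMeasure N]
    (f : C(unitInterval, ℝ)) (π : Policy) (t : ℕ) : IsProbabilityMeasure (historyLaw N f π t) := by
  induction t with
  | zero => rw [historyLaw]; infer_instance
  | succ t ih =>
    have := π.isMarkov t
    rw [historyLaw]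
    exact Measure.isProbabilityMeasure_map (measurable_historySnoc f t).aemeasurable

lemma lintegral_historyLaw_succ (N : Measure ℝ) [IsProbabilityMeasure N]
    (f : C(unitInterval, ℝ)) (π : Policy) (t : ℕ) {g : History (t + 1) → ℝ≥0∞}
    (hg : Measurable g) :
    ∫⁻ h, g h ∂historyLaw N f π (t + 1) =
      ∫⁻ h, ∫⁻ x, ∫⁻ e, g (Fin.snoc h (x, f x + e)) ∂N ∂π.next t h ∂historyLaw N f π t := by
  have := π.isMarkov t
  have := isProbabilityMeasure_historyLaw N f π t
  have hm := hg.comp (measurable_historySnoc f t)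
  rw [historyLaw, lintegral_map hg (measurable_historySnoc f t)]
  erw [lintegral_prod _ hm.aemeasurable]
  rw [Measure.lintegral_compProd]
  · rfl
  · exact hm.lintegral_prod_right'

/-- The shift of `N(0, 1/4)` by `d` has the likelihood ratio `exp (4 d e - 2 d ^ 2)`. -/
lemma lintegral_gaussianReal_add (d : ℝ) {g : ℝ → ℝ≥0∞} (hg : Measurable g) :
    ∫⁻ e, g (d + e) ∂gaussianReal 0 (1 / 4) =
      ∫⁻ e, ENNReal.ofReal (Real.exp (4 * d * e - 2 * d ^ 2)) * g e ∂gaussianReal 0 (1 / 4) := by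
  have hv : (1 / 4 : NNReal) ≠ 0 := by positivity
  rw [← lintegral_map (μ := gaussianReal 0 (1 / 4)) (f := g) (g := fun e => d + e) hg
    (by fun_prop), gaussianReal_map_const_add, zero_add, gaussianReal_of_var_ne_zero _ hv,
    gaussianReal_of_var_ne_zero _ hv,
    lintegral_withDensity_eq_lintegral_mul _ (measurable_gaussianPDF _ _) hg,
    lintegral_withDensity_eq_lintegral_mul _ (measurable_gaussianPDF _ _) (by fun_prop)]
  refine lintegral_congr fun e => ?_
  simp only [Pi.mul_apply]
  rw [← mul_assoc, gaussianPDF, gaussianPDF, ← ENNReal.ofReal_mul (gaussianPDFReal_nonneg _ _ _)]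
  congr 2
  rw [gaussianPDFReal, gaussianPDFReal, mul_assoc (_)⁻¹, ← Real.exp_add]
  congr 2
  push_cast
  ring

/-- The log-likelihood ratio of the history law of the reward function `f'` with respect to the one
of `f`, for Gaussian noise of variance `1 / 4`. -/
def logLikelihood (f f' : C(unitInterval, ℝ)) {t : ℕ} (h : History t) : ℝ :=
  ∑ s : Fin t, (4 * (f' (h s).1 - f (h s).1) * ((h s).2 - f (h s).1) -
    2 * (f' (h s).1 - f (h s).1) ^ 2)

lemma measurable_logLikelihood (f f' : C(unitInterval, ℝ)) (t : ℕ) :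
    Measurable fun h : History t => logLikelihood f f' h := by
  unfold logLikelihood
  fun_prop

lemma logLikelihood_snoc (f f' : C(unitInterval, ℝ)) {t : ℕ} (h : History t) (x : unitInterval)
    (y : ℝ) :
    logLikelihood f f' (Fin.snoc h (x, y) : History (t + 1)) = logLikelihood f f' h +
      (4 * (f' x - f x) * (y - f x) - 2 * (f' x - f x) ^ 2) := by
  simp only [logLikelihood, Fin.sum_univ_castSucc, Fin.snoc_castSucc, Fin.snoc_last]

lemma lintegral_historyLaw_eq (f f' : C(unitInterval, ℝ)) (π : Policy) (t : ℕ)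
    {g : History t → ℝ≥0∞} (hg : Measurable g) :
    ∫⁻ h, g h ∂historyLaw (gaussianReal 0 (1 / 4)) f' π t =
      ∫⁻ h, ENNReal.ofReal (Real.exp (logLikelihood f f' h)) * g h
        ∂historyLaw (gaussianReal 0 (1 / 4)) f π t := by
  induction t with
  | zero => simp [historyLaw, logLikelihood]
  | succ t ih =>
    have := π.isMarkov t
    have hmL := measurable_logLikelihood f f'
    rw [lintegral_historyLaw_succ _ _ _ _ hg, lintegral_historyLaw_succ _ _ _ _ (by fun_prop)]
    have hm := hg.comp (measurable_historySnoc f' t)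
    rw [ih]
    · refine lintegral_congr fun h => ?_
      rw [← lintegral_const_mul' _ _ ENNReal.ofReal_ne_top]
      refine lintegral_congr fun x => ?_
      have hsn : Measurable fun y : ℝ => g (Fin.snoc h (x, f x + y)) :=
        hg.comp ((measurable_historySnoc f t).comp (measurable_const.prodMk measurable_id :
          Measurable fun y : ℝ => ((h, x), y)))
      have := lintegral_gaussianReal_add (f' x - f x) hsn
      rw [show (fun e => g (Fin.snoc h (x, f' x + e))) =
        fun e => g (Fin.snoc h (x, f x + (f' x - f x + e))) by
          funext e; congr 3; ring, this, ← lintegral_const_mul' _ _ ENNReal.ofReal_ne_top]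
      refine lintegral_congr fun e => ?_
      rw [logLikelihood_snoc, Real.exp_add, ENNReal.ofReal_mul (Real.exp_nonneg _),
        mul_assoc (ENNReal.ofReal (Real.exp (logLikelihood f f' h))), add_sub_cancel_left]
    · have h1 : Measurable fun p : History t × unitInterval =>
          ∫⁻ e, g (Fin.snoc p.1 (p.2, f' p.2 + e)) ∂gaussianReal 0 (1 / 4) :=
        hm.lintegral_prod_right'
      exact h1.lintegral_kernel_prod_right'

/-- If the two reward functions are close in the squared distance summed along the histories in
`A`, then `A` is not much less likely under `f'` than under `f`. The reflection `2 f - f'` enters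
because its likelihood ratio is the inverse of that of `f'`, up to the exponential of four times
the summed squared distance. -/
lemma exp_mul_historyLaw_le (f f' : C(unitInterval, ℝ)) (π : Policy) (t : ℕ) {A : Set (History t)}
    (hA : MeasurableSet A) (q : ℝ)
    (hq : ∀ h ∈ A, ∑ s : Fin t, (f' (h s).1 - f (h s).1) ^ 2 ≤ q) :
    ENNReal.ofReal (Real.exp (-2 * q)) * historyLaw (gaussianReal 0 (1 / 4)) f π t A ≤
      ENNReal.ofReal (Real.exp (2 * q)) * historyLaw (gaussianReal 0 (1 / 4)) f' π t A +
        ENNReal.ofReal (Real.exp (-2 * q) / 4) := by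
  set f'' : C(unitInterval, ℝ) := f - (f' - f) with hf''
  set P := historyLaw (gaussianReal 0 (1 / 4)) f π t
  have h1 : historyLaw (gaussianReal 0 (1 / 4)) f' π t A =
      ∫⁻ h in A, ENNReal.ofReal (Real.exp (logLikelihood f f' h)) ∂P := by
    rw [← lintegral_indicator_one hA,
      lintegral_historyLaw_eq f f' π t (measurable_one.indicator hA), ← lintegral_indicator hA]
    refine lintegral_congr fun h => ?_
    by_cases hh : h ∈ A <;> simp [hh]
  have h2 : ∫⁻ h in A, ENNReal.ofReal (Real.exp (logLikelihood f f'' h)) ∂P ≤ 1 := by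
    have := isProbabilityMeasure_historyLaw (gaussianReal 0 (1 / 4)) f'' π t
    refine (setLIntegral_le_lintegral _ _).trans (le_of_eq ?_)
    have := lintegral_historyLaw_eq f f'' π t (g := fun _ => 1) measurable_const
    simpa only [mul_one, lintegral_one, measure_univ] using this.symm
  have hmL := measurable_logLikelihood f f' t
  have hmL' := measurable_logLikelihood f f'' t
  have h3 : ∀ h ∈ A, ENNReal.ofReal (Real.exp (-2 * q)) ≤
      ENNReal.ofReal (Real.exp (2 * q)) * ENNReal.ofReal (Real.exp (logLikelihood f f' h)) +
      ENNReal.ofReal (Real.exp (-2 * q) / 4) *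
        ENNReal.ofReal (Real.exp (logLikelihood f f'' h)) := by
    intro h hh
    rw [← ENNReal.ofReal_mul (by positivity), ← ENNReal.ofReal_mul (by positivity),
      ← ENNReal.ofReal_add (by positivity) (by positivity)]
    refine ENNReal.ofReal_le_ofReal ?_
    have hsum : logLikelihood f f' h + logLikelihood f f'' h =
        -4 * ∑ s : Fin t, (f' (h s).1 - f (h s).1) ^ 2 := by
      simp only [logLikelihood, hf'', ContinuousMap.sub_apply]
      rw [← Finset.sum_add_distrib, Finset.mul_sum]
      exact Finset.sum_congr rfl fun s _ => by ring
    have hl : -4 * q ≤ logLikelihood f f' h + logLikelihood f f'' h := by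
      rw [hsum]; linarith [hq h hh]
    set a := logLikelihood f f' h
    set b := logLikelihood f f'' h
    -- the geometric mean of the two summands is at least `exp (-2 q) / 2`
    have e1 : Real.exp (2 * q) * Real.exp a = Real.exp (q + a / 2) ^ 2 := by
      rw [← Real.exp_add, sq, ← Real.exp_add]; ring_nf
    have e2 : Real.exp (-2 * q) / 4 * Real.exp b = (Real.exp (-q + b / 2) / 2) ^ 2 := by
      rw [div_mul_eq_mul_div, ← Real.exp_add, div_pow, sq (Real.exp _), ← Real.exp_add]; ring_nf
    have e3 : Real.exp (-2 * q) ≤ Real.exp (q + a / 2) * Real.exp (-q + b / 2) := by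
      rw [← Real.exp_add]; exact Real.exp_le_exp.2 (by linarith)
    rw [e1, e2]
    nlinarith [sq_nonneg (Real.exp (q + a / 2) - Real.exp (-q + b / 2) / 2)]
  calc ENNReal.ofReal (Real.exp (-2 * q)) * P A
      = ∫⁻ h in A, ENNReal.ofReal (Real.exp (-2 * q)) ∂P := by simp
    _ ≤ ∫⁻ h in A, (ENNReal.ofReal (Real.exp (2 * q)) *
          ENNReal.ofReal (Real.exp (logLikelihood f f' h)) +
        ENNReal.ofReal (Real.exp (-2 * q) / 4) *
          ENNReal.ofReal (Real.exp (logLikelihood f f'' h))) ∂P := setLIntegral_mono' hA h3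
    _ = ENNReal.ofReal (Real.exp (2 * q)) *
          ∫⁻ h in A, ENNReal.ofReal (Real.exp (logLikelihood f f' h)) ∂P +
        ENNReal.ofReal (Real.exp (-2 * q) / 4) *
          ∫⁻ h in A, ENNReal.ofReal (Real.exp (logLikelihood f f'' h)) ∂P := by
      rw [lintegral_add_left (by fun_prop), lintegral_const_mul' _ _ ENNReal.ofReal_ne_top,
        lintegral_const_mul' _ _ ENNReal.ofReal_ne_top]
    _ ≤ _ := by
      rw [h1]
      gcongr
      exact mul_le_of_le_one_right' h2

/-- The number of rounds of `h` whose action lies in `D`. -/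
def visits (D : Set unitInterval) {t : ℕ} (h : History t) : ℝ :=
  ∑ s : Fin t, D.indicator (fun _ => (1 : ℝ)) (h s).1

lemma measurable_visits {D : Set unitInterval} (hD : MeasurableSet D) (t : ℕ) :
    Measurable fun h : History t => visits D h := by
  unfold visits
  refine Finset.measurable_sum _ fun s _ => ?_
  exact (measurable_const.indicator hD).comp (measurable_fst.comp (measurable_pi_apply s))

lemma visits_nonneg (D : Set unitInterval) {t : ℕ} (h : History t) : 0 ≤ visits D h :=
  Finset.sum_nonneg fun _ _ => Set.indicator_nonneg (fun _ _ => zero_le_one) _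

lemma sum_ofReal_gap_ge (f : C(unitInterval, ℝ)) (D : Set unitInterval) {ρ : ℝ} (hρ : 0 ≤ ρ)
    (hgap : ∀ x ∈ D, f x + ρ ≤ ⨆ x, f x) {t : ℕ} (h : History t) :
    ENNReal.ofReal (ρ * visits D h) ≤ ∑ s : Fin t, ENNReal.ofReal ((⨆ x, f x) - f (h s).1) := by
  rw [visits, Finset.mul_sum, ENNReal.ofReal_sum_of_nonneg]
  · refine Finset.sum_le_sum fun s _ => ?_
    by_cases hs : (h s).1 ∈ D
    · simp only [hs, Set.indicator_of_mem, mul_one]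
      exact ENNReal.ofReal_le_ofReal (by linarith [hgap _ hs])
    · simp [hs]
  · exact fun s _ => mul_nonneg hρ (Set.indicator_nonneg (fun _ _ => zero_le_one) _)

lemma visits_compl (D : Set unitInterval) {t : ℕ} (h : History t) :
    visits Dᶜ h = t - visits D h := by
  have : visits D h + visits Dᶜ h = t := by
    simp_rw [visits, ← Finset.sum_add_distrib, Set.indicator_self_add_compl_apply]
    simp
  linarith

/-- The trade-off between a base reward function `f₀` and its perturbations `f₁ i` on disjoint
bins `D i`: low regret against `f₀` forces the policy to visit some bin so rarely that it cannot
detect the perturbation there, and misses it most of the time. -/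
lemma exists_expectedRegret_ge (π : Policy) (T : ℕ) {K : ℕ} (f₀ : C(unitInterval, ℝ))
    (f₁ : Fin K → C(unitInterval, ℝ)) (D : Fin K → Set unitInterval)
    (hD : ∀ i, MeasurableSet (D i)) (hdisj : Pairwise (Function.onFun Disjoint D))
    {ρ M r : ℝ} (hρ : 0 < ρ)
    (hgap₀ : ∀ i, ∀ x ∈ D i, f₀ x + ρ ≤ ⨆ x, f₀ x)
    (hgap₁ : ∀ i, ∀ x ∉ D i, f₁ i x + ρ ≤ ⨆ x, f₁ i x)
    (heq : ∀ i, ∀ x ∉ D i, f₁ i x = f₀ x)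
    (hclose : ∀ i x, |f₁ i x - f₀ x| ≤ M * ρ)
    (hK : 0 < K) (hr : expectedRegret (gaussianReal 0 (1 / 4)) f₀ π T ≤ ENNReal.ofReal r)
    (hrK : 4 * r * ρ ≤ K) (hT : 2 ≤ T * ρ ^ 2) :
    ∃ i, ENNReal.ofReal (Real.exp (-4 * M ^ 2) / 4 * (ρ * T)) ≤
      expectedRegret (gaussianReal 0 (1 / 4)) (f₁ i) π T := by
  set P := historyLaw (gaussianReal 0 (1 / 4)) f₀ π T with hP
  have := isProbabilityMeasure_historyLaw (gaussianReal 0 (1 / 4)) f₀ π T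
  have hKr : (0 : ℝ) < K := by exact_mod_cast hK
  have hsum : ∑ i, ∫⁻ h, ENNReal.ofReal (visits (D i) h) ∂P ≤
      ∑ _i : Fin K, ENNReal.ofReal (1 / (4 * ρ ^ 2)) := by
    have e1 : ∀ h : History T, ∑ i, visits (D i) h = visits (⋃ i, D i) h := by
      intro h
      simp only [visits]
      rw [Finset.sum_comm]
      refine Finset.sum_congr rfl fun s _ => ?_
      by_cases hs : (h s).1 ∈ ⋃ i, D i
      · obtain ⟨i, hi⟩ := Set.mem_iUnion.1 hs
        rw [Set.indicator_of_mem hs, Finset.sum_eq_single i]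
        · simp [hi]
        · intro j _ hj
          exact Set.indicator_of_notMem
            (fun hj' => Set.disjoint_left.1 (hdisj hj) hj' hi) _
        · simp
      · rw [Set.indicator_of_notMem hs]
        exact Finset.sum_eq_zero fun i _ => Set.indicator_of_notMem
          (fun hi => hs (Set.mem_iUnion.2 ⟨i, hi⟩)) _
    have e2 : ENNReal.ofReal ρ * ∑ i, ∫⁻ h, ENNReal.ofReal (visits (D i) h) ∂P ≤
        ENNReal.ofReal r := by
      rw [← lintegral_finsetSum _ fun i _ => (measurable_visits (hD i) T).ennreal_ofReal,
        ← lintegral_const_mul' _ _ ENNReal.ofReal_ne_top]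
      refine le_trans (lintegral_mono fun h => ?_) hr
      rw [← ENNReal.ofReal_sum_of_nonneg fun i _ => visits_nonneg _ _, e1,
        ← ENNReal.ofReal_mul hρ.le]
      refine sum_ofReal_gap_ge _ _ hρ.le (fun x hx => ?_) h
      obtain ⟨i, hi⟩ := Set.mem_iUnion.1 hx
      exact hgap₀ i x hi
    rw [mul_comm, ← ENNReal.le_div_iff_mul_le (by simp [hρ]) (by simp),
      ← ENNReal.ofReal_div_of_pos hρ] at e2
    refine e2.trans ?_
    rw [Finset.sum_const, Finset.card_univ, Fintype.card_fin, nsmul_eq_mul,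
      ← ENNReal.ofReal_natCast, ← ENNReal.ofReal_mul (by positivity)]
    refine ENNReal.ofReal_le_ofReal ?_
    rw [mul_one_div, div_le_div_iff₀ hρ (by positivity)]
    nlinarith
  obtain ⟨i, hi⟩ : ∃ i, ∫⁻ h, ENNReal.ofReal (visits (D i) h) ∂P ≤
      ENNReal.ofReal (1 / (4 * ρ ^ 2)) := by
    by_contra! hcon
    have : Nonempty (Fin K) := Fin.pos_iff_nonempty.1 hK
    exact absurd hsum (not_le.2 (ENNReal.sum_lt_sum_of_nonempty Finset.univ_nonempty
      fun i _ => hcon i))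
  refine ⟨i, ?_⟩
  -- The event that the bin is visited too rarely for its spike to be noticed; it has probability at
  -- least `3 / 4` under `f₀`, by Markov's inequality.
  set A : Set (History T) := {h | visits (D i) h < 1 / ρ ^ 2} with hAdef
  have hmv := measurable_visits (hD i) T
  have hA : MeasurableSet A := measurableSet_lt hmv measurable_const
  have hρ2 : 0 < ρ ^ 2 := by positivity
  have hPA : ENNReal.ofReal (3 / 4) ≤ P A := by
    have hc : P Aᶜ ≤ ENNReal.ofReal (1 / 4) := by
      have hm := mul_meas_ge_le_lintegral₀ (μ := P) hmv.ennreal_ofReal.aemeasurable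
        (ENNReal.ofReal (1 / ρ ^ 2))
      have hs : {h | ENNReal.ofReal (1 / ρ ^ 2) ≤ ENNReal.ofReal (visits (D i) h)} = Aᶜ := by
        ext h
        simp only [hAdef, Set.mem_ofPred_eq, Set.mem_compl_iff, not_lt]
        exact ENNReal.ofReal_le_ofReal_iff (visits_nonneg _ _)
      rw [hs, mul_comm] at hm
      have := hm.trans hi
      rw [← ENNReal.le_div_iff_mul_le (Or.inl (ENNReal.ofReal_pos.2 (by positivity)).ne') (by simp),
        ← ENNReal.ofReal_div_of_pos (by positivity)] at this
      refine this.trans (le_of_eq ?_)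
      congr 1
      field_simp
    have h1 : P A = 1 - P Aᶜ := by
      rw [← prob_compl_eq_one_sub hA.compl, compl_compl]
    rw [h1, show (3 / 4 : ℝ) = 1 - 1 / 4 by norm_num, ENNReal.ofReal_sub _ (by norm_num),
      ENNReal.ofReal_one]
    gcongr
  have hq : ∀ h ∈ A, ∑ s : Fin T, (f₁ i (h s).1 - f₀ (h s).1) ^ 2 ≤ M ^ 2 := by
    intro h hh
    have h1 : ∑ s : Fin T, (f₁ i (h s).1 - f₀ (h s).1) ^ 2 ≤ (M * ρ) ^ 2 * visits (D i) h := by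
      rw [visits, Finset.mul_sum]
      refine Finset.sum_le_sum fun s _ => ?_
      by_cases hs : (h s).1 ∈ D i
      · simp only [hs, Set.indicator_of_mem, mul_one]
        exact sq_le_sq' (abs_le.1 (hclose i _)).1 (abs_le.1 (hclose i _)).2
      · simp [hs, heq i _ hs]
    refine h1.trans ?_
    have h2 : visits (D i) h ≤ 1 / ρ ^ 2 := le_of_lt hh
    calc (M * ρ) ^ 2 * visits (D i) h ≤ (M * ρ) ^ 2 * (1 / ρ ^ 2) := by gcongr
      _ = M ^ 2 := by field_simp
  have hinfo := exp_mul_historyLaw_le f₀ (f₁ i) π T hA (M ^ 2) hq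
  set P₁ := historyLaw (gaussianReal 0 (1 / 4)) (f₁ i) π T with hP₁
  have := isProbabilityMeasure_historyLaw (gaussianReal 0 (1 / 4)) (f₁ i) π T
  have hP₁A : Real.exp (-4 * M ^ 2) / 2 ≤ (P₁ A).toReal := by
    have hPA' : (3 / 4 : ℝ) ≤ (P A).toReal :=
      (ENNReal.ofReal_le_iff_le_toReal (measure_ne_top _ _)).1 hPA
    rw [← ENNReal.ofReal_toReal (measure_ne_top P A),
      ← ENNReal.ofReal_toReal (measure_ne_top P₁ A), ← ENNReal.ofReal_mul (by positivity),
      ← ENNReal.ofReal_mul (by positivity), ← ENNReal.ofReal_add (by positivity) (by positivity),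
      ENNReal.ofReal_le_ofReal_iff (by positivity)] at hinfo
    have h4 : Real.exp (-4 * M ^ 2) = Real.exp (-2 * M ^ 2) * Real.exp (-2 * M ^ 2) := by
      rw [← Real.exp_add]; ring_nf
    have h5 : Real.exp (2 * M ^ 2) * Real.exp (-2 * M ^ 2) = 1 := by
      rw [← Real.exp_add]; simp
    have hpos := Real.exp_pos (-2 * M ^ 2)
    have h6 : Real.exp (-2 * M ^ 2) / 2 ≤ Real.exp (2 * M ^ 2) * (P₁ A).toReal := by nlinarith
    calc Real.exp (-4 * M ^ 2) / 2 = Real.exp (-2 * M ^ 2) * (Real.exp (-2 * M ^ 2) / 2) := by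
          rw [h4]; ring
      _ ≤ Real.exp (-2 * M ^ 2) * (Real.exp (2 * M ^ 2) * (P₁ A).toReal) := by gcongr
      _ = (Real.exp (2 * M ^ 2) * Real.exp (-2 * M ^ 2)) * (P₁ A).toReal := by ring
      _ = _ := by rw [h5, one_mul]
  calc ENNReal.ofReal (Real.exp (-4 * M ^ 2) / 4 * (ρ * T))
      ≤ ENNReal.ofReal (ρ * T / 2) * P₁ A := by
        rw [← ENNReal.ofReal_toReal (measure_ne_top P₁ A), ← ENNReal.ofReal_mul (by positivity)]
        refine ENNReal.ofReal_le_ofReal ?_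
        have : 0 ≤ ρ * T := by positivity
        nlinarith
    _ = ∫⁻ h in A, ENNReal.ofReal (ρ * T / 2) ∂P₁ := by simp
    _ ≤ ∫⁻ h in A, ∑ s : Fin T, ENNReal.ofReal ((⨆ x, f₁ i x) - f₁ i (h s).1) ∂P₁ := by
        refine setLIntegral_mono' hA fun h hh => ?_
        refine le_trans (ENNReal.ofReal_le_ofReal ?_)
          (sum_ofReal_gap_ge (f₁ i) (D i)ᶜ hρ.le (fun x hx => hgap₁ i x hx) h)
        rw [visits_compl]
        have h2 : visits (D i) h ≤ 1 / ρ ^ 2 := le_of_lt hh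
        have h3 : 1 / ρ ^ 2 ≤ T / 2 := by
          rw [div_le_div_iff₀ hρ2 two_pos]; linarith
        nlinarith
    _ ≤ _ := setLIntegral_le_lintegral _ _

/-! ### Bessel functions of half-integer order -/

section Bessel

variable {z : ℝ}

lemma tendsto_exp_neg_mul_cosh_mul_exp (hz : 0 < z) (k : ℝ) :
    Tendsto (fun t => Real.exp (-z * Real.cosh t) * Real.exp (k * t)) atTop (nhds 0) := by
  simp_rw [← Real.exp_add]
  refine Real.tendsto_exp_atBot.comp ?_
  have h1 : Tendsto (fun t : ℝ => t * (z / 2 * (Real.exp t / t) - k)) atTop atTop := by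
    refine tendsto_id.atTop_mul_atTop₀ ?_
    refine tendsto_atTop_add_const_right _ _ (Tendsto.const_mul_atTop (by positivity) ?_)
    simpa using Real.tendsto_exp_div_pow_atTop 1
  refine tendsto_atBot_mono' _ ?_ (tendsto_neg_atTop_atBot.comp h1)
  filter_upwards [eventually_gt_atTop 0] with t ht
  simp only [Function.comp]
  have : t * (z / 2 * (Real.exp t / t) - k) = z * (Real.exp t / 2) - k * t := by
    field_simp
  rw [this, Real.cosh_eq]
  nlinarith [mul_pos hz (Real.exp_pos (-t))]

/-- Continuous functions of at most exponential growth on `[0, ∞)`; the factor `exp (-z cosh t)`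
makes them integrable. -/
def ExpBounded (g : ℝ → ℝ) : Prop :=
  Continuous g ∧ ∃ C k : ℝ, 0 ≤ k ∧ ∀ t, 0 ≤ t → |g t| ≤ C * Real.exp (k * t)

lemma expBounded_const (c : ℝ) : ExpBounded fun _ => c :=
  ⟨continuous_const, |c|, 0, le_rfl, fun t _ => by simp⟩

lemma ExpBounded.add {g g' : ℝ → ℝ} (h : ExpBounded g) (h' : ExpBounded g') :
    ExpBounded fun t => g t + g' t := by
  obtain ⟨hc, C, k, hk0, hk⟩ := h
  obtain ⟨hc', C', k', hk0', hk'⟩ := h'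
  have hC : 0 ≤ C := by simpa using (abs_nonneg _).trans (hk 0 le_rfl)
  have hC' : 0 ≤ C' := by simpa using (abs_nonneg _).trans (hk' 0 le_rfl)
  refine ⟨hc.add hc', C + C', k + k', by positivity, fun t ht => ?_⟩
  have h1 : Real.exp (k * t) ≤ Real.exp ((k + k') * t) := by gcongr; linarith
  have h2 : Real.exp (k' * t) ≤ Real.exp ((k + k') * t) := by gcongr; linarith
  calc |g t + g' t| ≤ |g t| + |g' t| := abs_add_le _ _
    _ ≤ C * Real.exp (k * t) + C' * Real.exp (k' * t) := add_le_add (hk t ht) (hk' t ht)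
    _ ≤ C * Real.exp ((k + k') * t) + C' * Real.exp ((k + k') * t) := by gcongr
    _ = _ := by ring

lemma ExpBounded.mul {g g' : ℝ → ℝ} (h : ExpBounded g) (h' : ExpBounded g') :
    ExpBounded fun t => g t * g' t := by
  obtain ⟨hc, C, k, hk0, hk⟩ := h
  obtain ⟨hc', C', k', hk0', hk'⟩ := h'
  refine ⟨hc.mul hc', C * C', k + k', by positivity, fun t ht => ?_⟩
  rw [abs_mul, add_mul, Real.exp_add, mul_mul_mul_comm]
  exact mul_le_mul (hk t ht) (hk' t ht) (abs_nonneg _) ((abs_nonneg _).trans (hk t ht))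

lemma ExpBounded.pow {g : ℝ → ℝ} (h : ExpBounded g) (n : ℕ) : ExpBounded fun t => g t ^ n := by
  induction n with
  | zero => simpa using expBounded_const 1
  | succ n ih => simpa only [pow_succ] using ih.mul h

lemma expBounded_cosh (ν : ℝ) : ExpBounded fun t => Real.cosh (ν * t) := by
  refine ⟨by fun_prop, 1, |ν|, abs_nonneg _, fun t ht => ?_⟩
  rw [abs_of_pos (Real.cosh_pos _), ← Real.cosh_abs, abs_mul, abs_of_nonneg ht, Real.cosh_eq]
  have : Real.exp (-(|ν| * t)) ≤ Real.exp (|ν| * t) := Real.exp_le_exp.2 (by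
    have : 0 ≤ |ν| * t := by positivity
    linarith)
  linarith

lemma expBounded_sinh (ν : ℝ) : ExpBounded fun t => Real.sinh (ν * t) := by
  obtain ⟨-, C, k, hk0, hk⟩ := expBounded_cosh ν
  refine ⟨by fun_prop, C, k, hk0, fun t ht => le_trans ?_ (hk t ht)⟩
  rw [Real.abs_sinh, abs_of_pos (Real.cosh_pos _), ← Real.cosh_abs]
  exact (Real.sinh_lt_cosh _).le

lemma ExpBounded.tendsto {g : ℝ → ℝ} (hz : 0 < z) (h : ExpBounded g) :
    Tendsto (fun t => Real.exp (-z * Real.cosh t) * g t) atTop (nhds 0) := by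
  obtain ⟨-, C, k, -, hk⟩ := h
  have := (tendsto_exp_neg_mul_cosh_mul_exp hz k).const_mul C
  rw [mul_zero] at this
  refine squeeze_zero_norm' ?_ this
  filter_upwards [eventually_ge_atTop 0] with t ht
  rw [Real.norm_eq_abs, abs_mul, abs_of_pos (Real.exp_pos _), mul_left_comm]
  exact mul_le_mul_of_nonneg_left (hk t ht) (Real.exp_nonneg _)

lemma ExpBounded.integrableOn {g : ℝ → ℝ} (hz : 0 < z) (h : ExpBounded g) :
    IntegrableOn (fun t => Real.exp (-z * Real.cosh t) * g t) (Set.Ioi 0) := by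
  have hexp : ExpBounded fun t => Real.exp (1 * t) :=
    ⟨by fun_prop, 1, 1, zero_le_one, fun t _ => by simp⟩
  refine integrable_of_isBigO_exp_neg one_pos ?_ ?_
  · have := h.1
    exact Continuous.continuousOn (by fun_prop)
  · refine Asymptotics.IsBigO.of_bound 1 ?_
    filter_upwards [((h.mul hexp).tendsto hz).norm.eventually_lt_const
      (show ‖(0 : ℝ)‖ < 1 by simp)] with t ht
    rw [← mul_assoc, norm_mul] at ht
    simp only [Real.norm_eq_abs, Real.abs_exp] at ht ⊢
    rw [neg_mul 1 t, Real.exp_neg (1 * t), one_mul, ← one_div, le_div_iff₀ (Real.exp_pos _)]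
    exact ht.le

/-- Integration by parts against `exp (-z cosh t) sinh t`. -/
lemma mul_integral_exp_mul_sinh {g g' : ℝ → ℝ} (hz : 0 < z) (hg : ExpBounded g)
    (hg' : ExpBounded g') (hderiv : ∀ t, HasDerivAt g (g' t) t) :
    z * ∫ t in Set.Ioi 0, Real.exp (-z * Real.cosh t) * (Real.sinh t * g t) =
      Real.exp (-z) * g 0 + ∫ t in Set.Ioi 0, Real.exp (-z * Real.cosh t) * g' t := by
  have hs : ExpBounded fun t => Real.sinh t := by simpa using expBounded_sinh 1
  have hd : ∀ t ∈ Set.Ici (0 : ℝ), HasDerivAt (fun t => Real.exp (-z * Real.cosh t) * g t)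
      (-z * (Real.exp (-z * Real.cosh t) * (Real.sinh t * g t)) +
        Real.exp (-z * Real.cosh t) * g' t) t := by
    intro t _
    refine ((((Real.hasDerivAt_cosh t).const_mul (-z)).exp).mul (hderiv t)).congr_deriv ?_
    ring
  have i1 := (hs.mul hg).integrableOn hz
  have i2 := hg'.integrableOn hz
  have := integral_Ioi_of_hasDerivAt_of_tendsto' hd ((i1.const_mul (-z)).add i2) (hg.tendsto hz)
  rw [integral_add (i1.const_mul (-z)) i2, integral_const_mul] at this
  simp only [Real.cosh_zero, mul_one] at this
  linarith

lemma besselK_neg (ν z : ℝ) : besselK (-ν) z = besselK ν z := by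
  simp [besselK, Real.cosh_neg]

lemma besselK_add_one (hz : 0 < z) (ν : ℝ) :
    besselK (ν + 1) z = besselK (ν - 1) z + 2 * ν / z * besselK ν z := by
  have h := mul_integral_exp_mul_sinh hz (expBounded_sinh ν)
    (show ExpBounded fun t => ν * Real.cosh (ν * t) from ?_) ?_
  · have h1 : besselK (ν + 1) z - besselK (ν - 1) z =
        2 * ∫ t in Set.Ioi 0, Real.exp (-z * Real.cosh t) * (Real.sinh t * Real.sinh (ν * t)) := by
      rw [besselK, besselK, ← integral_sub ((expBounded_cosh _).integrableOn hz)
        ((expBounded_cosh _).integrableOn hz), ← integral_const_mul]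
      refine integral_congr_ae (Eventually.of_forall fun t => ?_)
      simp only
      rw [add_mul, sub_mul, one_mul, Real.cosh_add, Real.cosh_sub]
      ring
    have h2 : ∫ t in Set.Ioi 0, Real.exp (-z * Real.cosh t) * (ν * Real.cosh (ν * t)) =
        ν * besselK ν z := by
      rw [besselK, ← integral_const_mul]
      exact integral_congr_ae (Eventually.of_forall fun t => by ring)
    rw [h2] at h
    simp only [mul_zero, Real.sinh_zero, zero_add] at h
    field_simp
    linear_combination z * h1 + 2 * h
  · exact (expBounded_const ν).mul (expBounded_cosh ν)
  · intro t
    have := ((hasDerivAt_id t).const_mul ν).sinh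
    simpa [mul_comm] using this

lemma besselK_one_half (z : ℝ) :
    besselK (1 / 2) z = √(Real.pi / (2 * z)) * Real.exp (-z) := by
  have himg : (fun t => Real.sinh (t / 2)) '' Set.Ioi 0 = Set.Ioi 0 := by
    ext u
    constructor
    · rintro ⟨t, ht, rfl⟩
      exact Real.sinh_pos_iff.2 (half_pos ht)
    · intro hu
      exact ⟨2 * Real.arsinh u, mul_pos two_pos (Real.arsinh_pos_iff.2 hu), by simp⟩
  have hsub := integral_image_eq_integral_abs_deriv_smul (measurableSet_Ioi (a := (0 : ℝ)))
    (f := fun t => Real.sinh (t / 2)) (f' := fun t => Real.cosh (t / 2) / 2)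
    (fun t _ => by
      have := ((hasDerivAt_id t).div_const 2).sinh
      refine (this.congr_deriv ?_).hasDerivWithinAt
      simp; ring)
    (fun t _ t' _ h => by
      have := Real.sinh_injective h
      linarith)
    (fun u => Real.exp (-(2 * z) * u ^ 2))
  rw [himg, integral_gaussian_Ioi] at hsub
  have h1 : ∫ t in Set.Ioi 0, |Real.cosh (t / 2) / 2| •
      Real.exp (-(2 * z) * Real.sinh (t / 2) ^ 2) = Real.exp z / 2 * besselK (1 / 2) z := by
    rw [besselK, ← integral_const_mul]
    refine integral_congr_ae (Eventually.of_forall fun t => ?_)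
    have hc : Real.cosh t = 1 + 2 * Real.sinh (t / 2) ^ 2 := by
      have := Real.cosh_two_mul (t / 2)
      rw [Real.cosh_sq, mul_div_cancel₀ _ two_ne_zero] at this
      linarith
    have hpos := Real.cosh_pos (t / 2)
    simp only [smul_eq_mul]
    rw [abs_of_pos (by positivity), hc, show -z * (1 + 2 * Real.sinh (t / 2) ^ 2) =
      -z + -(2 * z) * Real.sinh (t / 2) ^ 2 by ring, Real.exp_add, Real.exp_neg,
      show 1 / 2 * t = t / 2 by ring]
    field_simp
  rw [h1] at hsub
  rw [Real.exp_neg, ← div_eq_mul_inv, eq_div_iff (Real.exp_pos z).ne']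
  linarith

/-- The integral `∫₀^∞ exp (-z cosh t) sinh t ^ (2 n + 1) dt`, an integral representation of
`K_{n + 1/2} z` up to a factor. -/
def sinhIntegral (n : ℕ) (z : ℝ) : ℝ :=
  ∫ t in Set.Ioi (0 : ℝ), Real.exp (-z * Real.cosh t) * Real.sinh t ^ (2 * n + 1)

lemma sinhIntegral_zero (hz : 0 < z) : sinhIntegral 0 z = Real.exp (-z) / z := by
  have h := mul_integral_exp_mul_sinh hz (expBounded_const 1) (expBounded_const 0)
    (fun t => hasDerivAt_const t 1)
  simp only [mul_one, mul_zero, integral_zero, add_zero] at h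
  rw [eq_div_iff hz.ne', mul_comm, ← h]
  simp [sinhIntegral]

/-- The first of the two integrations by parts behind the recurrence for `sinhIntegral`. -/
lemma mul_sinhIntegral_succ (hz : 0 < z) (n : ℕ) :
    z * sinhIntegral (n + 1) z = 2 * (n + 1) *
      ∫ t in Set.Ioi 0, Real.exp (-z * Real.cosh t) *
        (Real.sinh t * (Real.sinh t ^ (2 * n) * Real.cosh t)) := by
  have hs : ExpBounded fun t => Real.sinh t := by simpa using expBounded_sinh 1
  have hc : ExpBounded fun t => Real.cosh t := by simpa using expBounded_cosh 1
  have h := mul_integral_exp_mul_sinh hz (hs.pow (2 * n + 2))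
    (((expBounded_const (2 * (n + 1))).mul (hs.mul ((hs.pow (2 * n)).mul hc))))
    (fun t => by
      refine ((Real.hasDerivAt_sinh t).pow (2 * n + 2)).congr_deriv ?_
      push_cast
      ring)
  have e1 : ∀ t, Real.exp (-z * Real.cosh t) * (Real.sinh t * Real.sinh t ^ (2 * n + 2)) =
      Real.exp (-z * Real.cosh t) * Real.sinh t ^ (2 * (n + 1) + 1) := fun t => by ring
  have e2 : ∀ t, Real.exp (-z * Real.cosh t) *
      (2 * (n + 1) * (Real.sinh t * (Real.sinh t ^ (2 * n) * Real.cosh t))) =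
      2 * (n + 1) * (Real.exp (-z * Real.cosh t) *
        (Real.sinh t * (Real.sinh t ^ (2 * n) * Real.cosh t))) := fun t => by ring
  simp only [e1, e2, integral_const_mul] at h
  simpa [sinhIntegral] using h

lemma sinhIntegral_one (hz : 0 < z) :
    sinhIntegral 1 z = 2 / z * (Real.exp (-z) / z + Real.exp (-z) / z ^ 2) := by
  have hs : ExpBounded fun t => Real.sinh t := by simpa using expBounded_sinh 1
  have hc : ExpBounded fun t => Real.cosh t := by simpa using expBounded_cosh 1
  have h := mul_sinhIntegral_succ hz 0
  have h2 := mul_integral_exp_mul_sinh hz hc hs Real.hasDerivAt_cosh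
  have h3 := sinhIntegral_zero hz
  simp only [sinhIntegral, mul_zero, zero_add, pow_one] at h3
  simp only [mul_zero, zero_add, pow_zero, one_mul, Nat.cast_zero, mul_one] at h
  rw [h3, Real.cosh_zero] at h2
  field_simp at h h2 ⊢
  linear_combination z ^ 2 * h + 2 * h2

lemma sinhIntegral_add_two (hz : 0 < z) (n : ℕ) :
    sinhIntegral (n + 2) z = 2 * (n + 2) / z ^ 2 *
      ((2 * n + 3) * sinhIntegral (n + 1) z + (2 * n + 2) * sinhIntegral n z) := by
  have hs : ExpBounded fun t => Real.sinh t := by simpa using expBounded_sinh 1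
  have hc : ExpBounded fun t => Real.cosh t := by simpa using expBounded_cosh 1
  have h := mul_sinhIntegral_succ hz (n + 1)
  have h2 := mul_integral_exp_mul_sinh hz ((hs.pow (2 * n + 2)).mul hc)
    (((expBounded_const (2 * n + 3)).mul (hs.pow (2 * (n + 1) + 1))).add
      ((expBounded_const (2 * n + 2)).mul (hs.pow (2 * n + 1))))
    (fun t => by
      refine (((Real.hasDerivAt_sinh t).pow (2 * n + 2)).mul
        (Real.hasDerivAt_cosh t)).congr_deriv ?_
      push_cast
      simp only [Pi.pow_apply]
      linear_combination (2 * n + 2) * Real.sinh t ^ (2 * n + 1) * Real.cosh_sq t)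
  have e1 : ∫ t in Set.Ioi 0, Real.exp (-z * Real.cosh t) *
      ((2 * n + 3) * Real.sinh t ^ (2 * (n + 1) + 1) + (2 * n + 2) * Real.sinh t ^ (2 * n + 1)) =
      (2 * n + 3) * sinhIntegral (n + 1) z + (2 * n + 2) * sinhIntegral n z := by
    rw [sinhIntegral, sinhIntegral, ← integral_const_mul, ← integral_const_mul,
      ← integral_add (((hs.pow _).integrableOn hz).const_mul _)
        (((hs.pow _).integrableOn hz).const_mul _)]
    exact integral_congr_ae (Eventually.of_forall fun t => by ring)
  rw [e1] at h2
  simp only [Real.sinh_zero, ne_eq, Nat.add_eq_zero_iff, OfNat.ofNat_ne_zero, and_false,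
    not_false_eq_true, zero_pow, zero_mul, mul_zero, zero_add] at h2
  rw [show 2 * (n + 1) = 2 * n + 2 by ring, show n + 1 + 1 = n + 2 by ring] at h
  push_cast at h
  field_simp
  linear_combination z * h + 2 * (n + 2) * h2

/-- The integral representation of the Bessel functions of half-integer order. Both sides satisfy
the same three-term recurrence in `n`. -/
lemma sinhIntegral_eq_besselK (hz : 0 < z) (n : ℕ) :
    sinhIntegral n z = n.factorial / √Real.pi * √(2 / z) * (2 / z) ^ n * besselK (n + 1 / 2) z := by
  have hK : besselK (1 / 2) z * √(2 / z) = √Real.pi * Real.exp (-z) / z := by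
    rw [besselK_one_half z, mul_right_comm, ← Real.sqrt_mul (by positivity),
      show Real.pi / (2 * z) * (2 / z) = Real.pi / z ^ 2 by field_simp,
      Real.sqrt_div' _ (by positivity), Real.sqrt_sq hz.le]
    ring
  have hπ : √Real.pi ≠ 0 := (Real.sqrt_pos.2 Real.pi_pos).ne'
  have key : sinhIntegral n z =
        n.factorial / √Real.pi * √(2 / z) * (2 / z) ^ n * besselK (n + 1 / 2) z ∧
      sinhIntegral (n + 1) z = (n + 1).factorial / √Real.pi * √(2 / z) * (2 / z) ^ (n + 1) *
        besselK ((n + 1 : ℕ) + 1 / 2) z := by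
    induction n with
    | zero =>
      have hK3 := besselK_add_one hz (1 / 2)
      rw [show (1 / 2 : ℝ) - 1 = -(1 / 2) by norm_num, besselK_neg] at hK3
      constructor
      · rw [sinhIntegral_zero hz]
        simp only [Nat.factorial_zero, Nat.cast_one, pow_zero, mul_one, Nat.cast_zero, zero_add]
        rw [mul_assoc, mul_comm √(2 / z), hK]
        field_simp
      · rw [zero_add, sinhIntegral_one hz, Nat.cast_one, add_comm 1, hK3]
        simp only [Nat.factorial_one, Nat.cast_one, pow_one]
        trans 1 / √Real.pi * (2 / z) * (besselK (1 / 2) z * √(2 / z)) * (1 + 1 / z)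
        · rw [hK]; field_simp
        · field_simp
    | succ n ih =>
      refine ⟨ih.2, ?_⟩
      have hK3 := besselK_add_one hz ((n + 1 : ℕ) + 1 / 2)
      rw [show (((n + 1 : ℕ) : ℝ) + 1 / 2) - 1 = n + 1 / 2 by push_cast; ring] at hK3
      rw [show ((n + 1 + 1 : ℕ) : ℝ) + 1 / 2 = ((n + 1 : ℕ) : ℝ) + 1 / 2 + 1 by push_cast; ring, hK3,
        sinhIntegral_add_two hz, ih.1, ih.2, Nat.factorial_succ (n + 1), Nat.factorial_succ n]
      push_cast
      simp only [div_pow]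
      field_simp
      ring
  exact key.1

end Bessel

/-! ### The RKHS of a Matérn kernel -/

/-- A function represented in the feature space of a kernel lies in the RKHS ball: the RKHS is
realised as the closed span of the feature vectors, onto which the representer is projected. -/
lemma mem_rkhsBall_of_feature {X : Type} [TopologicalSpace X] {E : Type} [NormedAddCommGroup E]
    [InnerProductSpace ℝ E] [CompleteSpace E] (φ : X → E) {k : X → X → ℝ}
    (hk : ∀ x x', inner ℝ (φ x) (φ x') = k x x') {f : C(X, ℝ)} {G : E}
    (hG : ∀ x, inner ℝ (φ x) G = f x) {B : ℝ} (hB : ‖G‖ ≤ B) : f ∈ rkhsBall k B := by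
  let S : Submodule ℝ E := (Submodule.span ℝ (Set.range φ)).topologicalClosure
  have hφS : ∀ x, φ x ∈ S := fun x =>
    Submodule.le_topologicalClosure _ (Submodule.subset_span ⟨x, rfl⟩)
  have hScl : IsClosed (S : Set E) := Submodule.isClosed_topologicalClosure _
  have : CompleteSpace S := hScl.completeSpace_coe
  let inst : RKHS ℝ S X ℝ :=
    { coeCLM := ContinuousLinearMap.pi fun x => (innerSL ℝ (φ x)).comp S.subtypeL
      coeCLM_injective := by
        refine (injective_iff_map_eq_zero _).2 fun g hg => ?_
        have h1 : ∀ x, inner ℝ (φ x) (g : E) = 0 := fun x => congrFun hg x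
        have h2 : (g : E) ∈ Sᗮ := by
          rw [Submodule.orthogonal_closure, Submodule.mem_orthogonal]
          intro u hu
          induction hu using Submodule.span_induction with
          | mem u hu => obtain ⟨x, rfl⟩ := hu; exact h1 x
          | zero => simp
          | add u v _ _ hu hv => rw [inner_add_left, hu, hv, add_zero]
          | smul c u _ hu => rw [inner_smul_left, hu, mul_zero]
        have h3 : (g : E) ∈ S ⊓ Sᗮ := ⟨g.2, h2⟩
        rw [Submodule.inf_orthogonal_eq_bot] at h3
        exact Subtype.ext ((Submodule.mem_bot ℝ).1 h3) }
  have happ : ∀ (g : S) (x : X), g x = inner ℝ (φ x) (g : E) := fun g x => rfl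
  have hker : ∀ x, RKHS.kerFun S x (1 : ℝ) = (⟨φ x, hφS x⟩ : S) := by
    intro x
    refine ext_inner_left ℝ fun v => ?_
    rw [RKHS.inner_kerFun, happ, Submodule.coe_inner, real_inner_comm]
    exact (mul_one _).symm.trans (by simp [real_inner_comm])
  refine ⟨S, inferInstance, inferInstance, this, inst, fun x x' => ?_,
    S.orthogonalProjectionOnto G, ?_, ?_⟩
  · rw [← RKHS.kerFun_apply, hker, happ, hk]
  · funext x
    rw [happ, ← hG x]
    exact Submodule.inner_orthogonalProjectionOnto_eq_of_mem_left (⟨φ x, hφS x⟩ : S) G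
  · exact (Submodule.norm_orthogonalProjectionOnto_apply_le S G).trans hB

/-- The impulse response `u ^ n exp (-a u)` for `u > 0` of the filter that inverts `(d / dx + a)`
applied `n + 1` times, up to a factor. Its autocorrelation is the Matérn kernel of order
`n + 1 / 2`, up to a factor. -/
def gammaFilter (n : ℕ) (a u : ℝ) : ℝ :=
  (Set.Ioi (0 : ℝ)).indicator (fun u => u ^ n * Real.exp (-a * u)) u

lemma measurable_gammaFilter (n : ℕ) (a : ℝ) : Measurable (gammaFilter n a) :=
  Measurable.indicator (by fun_prop) measurableSet_Ioi

lemma gammaFilter_sq (n : ℕ) (a u : ℝ) : gammaFilter n a u ^ 2 =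
    (Set.Ioi (0 : ℝ)).indicator (fun u => u ^ (2 * n) * Real.exp (-(2 * a * u))) u := by
  by_cases hu : u ∈ Set.Ioi (0 : ℝ)
  · simp only [gammaFilter, Set.indicator_of_mem hu]
    rw [mul_pow, ← pow_mul, ← Real.exp_nat_mul, mul_comm n]
    congr 2
    push_cast; ring
  · simp [gammaFilter, Set.indicator_of_notMem hu]

lemma integrable_gammaFilter_sq (n : ℕ) {a : ℝ} (ha : 0 < a) :
    Integrable fun u => gammaFilter n a u ^ 2 := by
  simp_rw [gammaFilter_sq]
  rw [integrable_indicator_iff measurableSet_Ioi]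
  have := integrableOn_rpow_mul_exp_neg_mul_rpow (p := 1) (s := (2 * n : ℕ)) (b := 2 * a)
    (by have : (0 : ℝ) ≤ (2 * n : ℕ) := by positivity
        linarith) one_pos (by positivity)
  simpa only [Real.rpow_natCast, Real.rpow_one, neg_mul] using this

lemma integral_gammaFilter_sq (n : ℕ) {a : ℝ} (ha : 0 < a) :
    ∫ u, gammaFilter n a u ^ 2 = (2 * n).factorial / (2 * a) ^ (2 * n + 1) := by
  simp_rw [gammaFilter_sq]
  rw [integral_indicator measurableSet_Ioi]
  have := Real.integral_rpow_mul_exp_neg_mul_Ioi (a := (2 * n : ℕ) + 1) (r := 2 * a)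
    (by positivity) (by positivity)
  rw [add_sub_cancel_right, Real.Gamma_nat_eq_factorial] at this
  simp only [Real.rpow_natCast] at this
  rw [this, ← Nat.cast_succ, Real.rpow_natCast, one_div, inv_pow]
  field_simp

/-- The substitution `u = d (cosh t - 1) / 2` turns the autocorrelation of the filter into the
integral representation of the Bessel function. -/
lemma integral_gammaFilter_mul_shift (n : ℕ) {a d : ℝ} (hd : 0 < d) :
    ∫ u, gammaFilter n a u * gammaFilter n a (u + d) =
      (d / 2) ^ (2 * n + 1) * sinhIntegral n (a * d) := by
  have h1 : ∫ u, gammaFilter n a u * gammaFilter n a (u + d) =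
      ∫ u in Set.Ioi 0, (u * (u + d)) ^ n * Real.exp (-a * (2 * u + d)) := by
    rw [← integral_indicator measurableSet_Ioi]
    refine integral_congr_ae (Eventually.of_forall fun u => ?_)
    by_cases hu : u ∈ Set.Ioi (0 : ℝ)
    · have hu' : u + d ∈ Set.Ioi (0 : ℝ) := add_pos hu hd
      simp only [gammaFilter, Set.indicator_of_mem hu, Set.indicator_of_mem hu']
      rw [mul_mul_mul_comm, ← mul_pow, ← Real.exp_add]
      congr 2; ring
    · simp [gammaFilter, Set.indicator_of_notMem hu]
  have himg : (fun t => d * (Real.cosh t - 1) / 2) '' Set.Ioi 0 = Set.Ioi 0 := by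
    ext u
    constructor
    · rintro ⟨t, ht, rfl⟩
      have : 1 < Real.cosh t := Real.one_lt_cosh.2 (ne_of_gt ht)
      have : 0 < Real.cosh t - 1 := by linarith
      exact Set.mem_Ioi.2 (by positivity)
    · intro hu
      have hu : 0 < u := hu
      refine ⟨2 * Real.arsinh √(u / d), ?_, ?_⟩
      · exact mul_pos two_pos (Real.arsinh_pos_iff.2 (Real.sqrt_pos.2 (by positivity)))
      · simp only
        rw [Real.cosh_two_mul, Real.cosh_sq, Real.sinh_arsinh, Real.sq_sqrt (by positivity)]
        field_simp
        ring
  have hsub := integral_image_eq_integral_abs_deriv_smul (measurableSet_Ioi (a := (0 : ℝ)))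
    (f := fun t => d * (Real.cosh t - 1) / 2) (f' := fun t => d * Real.sinh t / 2)
    (fun t _ => ((((Real.hasDerivAt_cosh t).sub_const 1).const_mul d).div_const 2).hasDerivWithinAt)
    (fun t ht t' ht' h => by
      have h2 : Real.cosh t = Real.cosh t' := by
        have h3 := mul_left_cancel₀ hd.ne' ((div_left_inj' two_ne_zero).1 h)
        linarith
      exact Real.cosh_strictMonoOn.injOn (Set.Ioi_subset_Ici_self ht)
        (Set.Ioi_subset_Ici_self ht') h2)
    (fun u => (u * (u + d)) ^ n * Real.exp (-a * (2 * u + d)))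
  rw [h1, ← himg, hsub, sinhIntegral, ← integral_const_mul]
  refine setIntegral_congr_fun measurableSet_Ioi fun t ht => ?_
  have hs : 0 < Real.sinh t := Real.sinh_pos_iff.2 ht
  simp only [smul_eq_mul]
  rw [abs_of_pos (by positivity), show d * (Real.cosh t - 1) / 2 * (d * (Real.cosh t - 1) / 2 + d) =
    (d / 2 * Real.sinh t) ^ 2 by rw [mul_pow, Real.sinh_sq]; ring,
    show -a * (2 * (d * (Real.cosh t - 1) / 2) + d) = -(a * d) * Real.cosh t by ring, ← pow_mul]
  ring

/-- The normalising factor that makes the filter a unit vector of `L²`. -/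
def filterNorm (n : ℕ) (a : ℝ) : ℝ := √((2 * a) ^ (2 * n + 1) / (2 * n).factorial)

lemma filterNorm_pos (n : ℕ) {a : ℝ} (ha : 0 < a) : 0 < filterNorm n a :=
  Real.sqrt_pos.2 (by positivity)

lemma filterNorm_sq (n : ℕ) {a : ℝ} (ha : 0 < a) :
    filterNorm n a ^ 2 = (2 * a) ^ (2 * n + 1) / (2 * n).factorial :=
  Real.sq_sqrt (by positivity)

lemma filterNorm_sq_mul_sinhIntegral (n : ℕ) {a d : ℝ} (ha : 0 < a) (hd : 0 < d) :
    filterNorm n a ^ 2 * ((d / 2) ^ (2 * n + 1) * sinhIntegral n (a * d)) =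
      2 ^ (1 - ((n : ℝ) + 1 / 2)) / Real.Gamma (n + 1 / 2) * (a * d) ^ ((n : ℝ) + 1 / 2) *
        besselK (n + 1 / 2) (a * d) := by
  have hz : 0 < a * d := mul_pos ha hd
  have hdup := Real.Gamma_mul_Gamma_add_half ((n : ℝ) + 1 / 2)
  rw [show (n : ℝ) + 1 / 2 + 1 / 2 = n + 1 by ring, Real.Gamma_nat_eq_factorial,
    show 2 * ((n : ℝ) + 1 / 2) = (2 * n : ℕ) + 1 by push_cast; ring, Real.Gamma_nat_eq_factorial,
    show (1 : ℝ) - ((2 * n : ℕ) + 1) = -(2 * n : ℕ) by ring, Real.rpow_neg two_pos.le,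
    Real.rpow_natCast] at hdup
  have hΓ : 0 < Real.Gamma (n + 1 / 2) := Real.Gamma_pos_of_pos (by positivity)
  have hπ : 0 < √Real.pi := Real.sqrt_pos.2 Real.pi_pos
  have h2 : (2 : ℝ) ^ (1 - ((n : ℝ) + 1 / 2)) = √2 / 2 ^ n := by
    rw [show 1 - ((n : ℝ) + 1 / 2) = 1 / 2 - n by ring, Real.rpow_sub two_pos, Real.rpow_natCast,
      Real.sqrt_eq_rpow]
  have h3 : (a * d) ^ ((n : ℝ) + 1 / 2) = (a * d) ^ n * √(a * d) := by
    rw [Real.rpow_add hz, Real.rpow_natCast, Real.sqrt_eq_rpow]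
  have h4 : (n.factorial : ℝ) / ((2 * n).factorial * √Real.pi) =
      1 / (2 ^ (2 * n) * Real.Gamma (n + 1 / 2)) := by
    rw [div_eq_div_iff (by positivity) (by positivity)]
    have h8 : (2 : ℝ) ^ (2 * n) * (2 ^ (2 * n))⁻¹ = 1 := mul_inv_cancel₀ (by positivity)
    linear_combination 2 ^ (2 * n) * hdup + (2 * n).factorial * √Real.pi * h8
  have h5 : √(2 / (a * d)) = √2 / √(a * d) := Real.sqrt_div two_pos.le _
  have h6 : √(a * d) * √(a * d) = a * d := Real.mul_self_sqrt hz.le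
  have h7 : 0 < √(a * d) := Real.sqrt_pos.2 hz
  rw [sinhIntegral_eq_besselK hz, filterNorm_sq n ha, h2, h3, h5]
  calc _ = ((2 * a) * (d / 2)) ^ (2 * n + 1) * (2 / (a * d)) ^ n * (√2 / √(a * d)) *
        ((n.factorial : ℝ) / ((2 * n).factorial * √Real.pi)) * besselK (n + 1 / 2) (a * d) := by
        rw [mul_pow (2 * a)]; ring
    _ = (a * d) ^ (2 * n + 1) * (2 / (a * d)) ^ n * (√2 / √(a * d)) *
        (1 / (2 ^ (2 * n) * Real.Gamma (n + 1 / 2))) * besselK (n + 1 / 2) (a * d) := by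
        rw [h4, show 2 * a * (d / 2) = a * d by ring]
    _ = _ := by
        generalize a * d = z at *
        rw [show z ^ (2 * n + 1) = z ^ n * z ^ n * (√z * √z) by rw [h6]; ring, div_pow,
          show (2 : ℝ) ^ (2 * n) = 2 ^ n * 2 ^ n by ring]
        field_simp

/-- The feature vector of `x`: the filter started at `x`, running backwards in time. -/
def maternFeature (n : ℕ) (a x s : ℝ) : ℝ := filterNorm n a * gammaFilter n a (x - s)

lemma memLp_maternFeature (n : ℕ) {a : ℝ} (ha : 0 < a) (x : ℝ) :
    MemLp (maternFeature n a x) 2 := by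
  have hm : Measurable (maternFeature n a x) :=
    ((measurable_gammaFilter n a).comp (by fun_prop)).const_mul _
  rw [memLp_two_iff_integrable_sq hm.aestronglyMeasurable]
  have := ((integrable_gammaFilter_sq n ha).comp_sub_left x).const_mul (filterNorm n a ^ 2)
  simpa only [maternFeature, mul_pow] using this

lemma integral_maternFeature_mul (n : ℕ) {a : ℝ} (x y : ℝ) :
    ∫ s, maternFeature n a x s * maternFeature n a y s =
      filterNorm n a ^ 2 * ∫ u, gammaFilter n a u * gammaFilter n a (u + (y - x)) := by
  rw [← integral_sub_left_eq_self (fun u => gammaFilter n a u * gammaFilter n a (u + (y - x))) _ x,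
    ← integral_const_mul]
  refine integral_congr_ae (Eventually.of_forall fun s => ?_)
  simp only [maternFeature]
  rw [show x - s + (y - x) = y - s by ring]
  ring

lemma integral_maternFeature_eq_kernel (n : ℕ) {l : ℝ} (hl : 0 < l) (x y : ℝ) :
    ∫ s, maternFeature n (√(2 * (n + 1 / 2)) / l) x s *
        maternFeature n (√(2 * (n + 1 / 2)) / l) y s =
      maternKernel (n + 1 / 2) l x y := by
  set a := √(2 * ((n : ℝ) + 1 / 2)) / l with ha_def
  have ha : 0 < a := div_pos (Real.sqrt_pos.2 (by positivity)) hl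
  have hlt : ∀ x y : ℝ, x < y → ∫ s, maternFeature n a x s * maternFeature n a y s =
      maternKernel (n + 1 / 2) l x y := by
    intro x y hxy
    have hd : 0 < y - x := sub_pos.2 hxy
    rw [integral_maternFeature_mul, integral_gammaFilter_mul_shift n hd,
      filterNorm_sq_mul_sinhIntegral n ha hd, maternKernel, if_neg hxy.ne, abs_sub_comm,
      abs_of_pos hd, show √(2 * ((n : ℝ) + 1 / 2)) * (y - x) / l = a * (y - x) by
        rw [ha_def]; ring]
  rcases lt_trichotomy x y with h | rfl | h
  · exact hlt x y h
  · rw [integral_maternFeature_mul, maternKernel, if_pos rfl, filterNorm_sq n ha]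
    simp only [sub_self, add_zero, ← sq]
    rw [integral_gammaFilter_sq n ha]
    field_simp
  · have h1 : maternKernel (n + 1 / 2) l x y = maternKernel (n + 1 / 2) l y x := by
      simp only [maternKernel, eq_comm (a := x), abs_sub_comm x]
    rw [h1, ← hlt y x h]
    exact integral_congr_ae (Eventually.of_forall fun s => mul_comm _ _)

/-- The functions on `[0, 1]` that are represented in `L²` by `G`, through the features of the
Matérn kernel, lie in its RKHS ball. -/
lemma mem_maternBall_of_integral (n : ℕ) {l : ℝ} (hl : 0 < l) {f : C(unitInterval, ℝ)} {G : ℝ → ℝ}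
    (hG : MemLp G 2)
    (hf : ∀ x : unitInterval, ∫ s, maternFeature n (√(2 * (n + 1 / 2)) / l) x s * G s = f x)
    {B : ℝ} (hB0 : 0 ≤ B) (hB : ∫ s, G s ^ 2 ≤ B ^ 2) : f ∈ maternBall (n + 1 / 2) l B := by
  set a := √(2 * ((n : ℝ) + 1 / 2)) / l with ha_def
  have ha : 0 < a := div_pos (Real.sqrt_pos.2 (by positivity)) hl
  have hinner : ∀ {u v : ℝ → ℝ} (hu : MemLp u 2) (hv : MemLp v 2),
      inner ℝ (hu.toLp u) (hv.toLp v) = ∫ s, u s * v s := by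
    intro u v hu hv
    rw [L2.inner_def]
    refine integral_congr_ae ?_
    filter_upwards [hu.coeFn_toLp, hv.coeFn_toLp] with s h1 h2
    rw [h1, h2]
    simp [mul_comm]
  refine mem_rkhsBall_of_feature
    (fun x : unitInterval => (memLp_maternFeature n ha (x : ℝ)).toLp (maternFeature n a x))
    (fun x x' => ?_) (G := hG.toLp G) (fun x => ?_) ?_
  · rw [hinner, integral_maternFeature_eq_kernel n hl]
  · rw [hinner, hf]
  · refine abs_le_of_sq_le_sq' ?_ hB0 |>.2
    rw [← real_inner_self_eq_norm_sq, hinner]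
    simpa only [← sq] using hB

/-! ### Smooth functions in the Matérn ball -/

lemma eq_integral_of_eventuallyEq_zero {w : ℝ → ℝ} {n : ℕ} (hw : ContDiff ℝ (n + 1 : ℕ) w)
    (hw0 : w =ᶠ[nhds 0] fun _ => 0) {x : ℝ} (hx : 0 ≤ x) :
    w x = ∫ s in Set.Ioo 0 x, (x - s) ^ n / n.factorial * iteratedDeriv (n + 1) w s := by
  rcases hx.eq_or_lt with rfl | hx
  · simpa using hw0.eq_of_nhds
  have hu : Set.uIcc 0 x = Set.Icc 0 x := Set.uIcc_of_le hx.le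
  have hud : UniqueDiffOn ℝ (Set.uIcc 0 x) := hu ▸ uniqueDiffOn_Icc hx
  have h := taylor_integral_remainder (x₀ := 0) (x := x) hw.contDiffOn
  have h0 : taylorWithinEval w n (Set.uIcc 0 x) 0 x = 0 := by
    rw [taylor_within_apply]
    refine Finset.sum_eq_zero fun k hk => ?_
    have hk : k ≤ n + 1 := by have := Finset.mem_range.1 hk; omega
    rw [iteratedDerivWithin_eq_iteratedDeriv hud
      ((hw.of_le (by exact_mod_cast hk)).contDiffAt) (by simp), hw0.iteratedDeriv_eq]
    simp
  rw [h0, sub_zero, intervalIntegral.integral_of_le hx.le, integral_Ioc_eq_integral_Ioo] at h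
  rw [h]
  refine setIntegral_congr_fun measurableSet_Ioo fun s hs => ?_
  simp only [smul_eq_mul]
  rw [iteratedDerivWithin_eq_iteratedDeriv hud hw.contDiffAt (by
    rw [hu]; exact Set.Ioo_subset_Icc_self hs)]

/-- A function `exp (-a x) w x`, where `w` vanishes near `0`, is the output of the filter for an
input that is a multiple of `exp (-a s)` times the `n + 1`st derivative of `w`. -/
lemma mem_maternBall_of_contDiff (n : ℕ) {l : ℝ} (hl : 0 < l) {w : ℝ → ℝ}
    (hw : ContDiff ℝ (n + 1 : ℕ) w) (hw0 : w =ᶠ[nhds 0] fun _ => 0) {f : C(unitInterval, ℝ)}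
    (hf : ∀ x : unitInterval, f x = Real.exp (-(√(2 * (n + 1 / 2)) / l) * x) * w x)
    {B : ℝ} (hB0 : 0 ≤ B)
    (hB : ∫ s in Set.Ioc 0 1, iteratedDeriv (n + 1) w s ^ 2 ≤
      (filterNorm n (√(2 * (n + 1 / 2)) / l) * n.factorial * B) ^ 2) :
    f ∈ maternBall (n + 1 / 2) l B := by
  set a := √(2 * ((n : ℝ) + 1 / 2)) / l with ha_def
  have ha : 0 < a := div_pos (Real.sqrt_pos.2 (by positivity)) hl
  have hc := filterNorm_pos n ha
  set c := filterNorm n a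
  have hn : (0 : ℝ) < n.factorial := by positivity
  set D := iteratedDeriv (n + 1) w with hD
  have hDc : Continuous D := hw.continuous_iteratedDeriv (n + 1) le_rfl
  set G : ℝ → ℝ := (Set.Ioc (0 : ℝ) 1).indicator
    (fun s => Real.exp (-a * s) * D s / (c * n.factorial)) with hGdef
  have hGm : Measurable G := Measurable.indicator (by fun_prop) measurableSet_Ioc
  have hG2 : ∀ s, G s ^ 2 = (Set.Ioc (0 : ℝ) 1).indicator
      (fun s => (Real.exp (-a * s) * D s / (c * n.factorial)) ^ 2) s := by
    intro s
    by_cases hs : s ∈ Set.Ioc (0 : ℝ) 1 <;> simp [hGdef, hs]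
  have hint : ∀ g : ℝ → ℝ, Continuous g → IntegrableOn g (Set.Ioc 0 1) := fun g hg =>
    (hg.continuousOn.integrableOn_compact isCompact_Icc).mono_set Set.Ioc_subset_Icc_self
  refine mem_maternBall_of_integral n hl (G := G) ?_ (fun x => ?_) hB0 ?_
  · rw [memLp_two_iff_integrable_sq hGm.aestronglyMeasurable]
    simp_rw [hG2]
    rw [integrable_indicator_iff measurableSet_Ioc]
    exact hint _ (by fun_prop)
  · have hx0 : (0 : ℝ) ≤ x := x.2.1
    have hx1 : (x : ℝ) ≤ 1 := x.2.2
    rw [hf, eq_integral_of_eventuallyEq_zero hw hw0 hx0, ← integral_const_mul,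
      ← integral_indicator measurableSet_Ioo]
    refine integral_congr_ae (Eventually.of_forall fun s => ?_)
    by_cases hs : s ∈ Set.Ioo (0 : ℝ) x
    · have h1 : s ∈ Set.Ioc (0 : ℝ) 1 := ⟨hs.1, hs.2.le.trans hx1⟩
      have h2 : (x : ℝ) - s ∈ Set.Ioi (0 : ℝ) := sub_pos.2 hs.2
      simp only [maternFeature, gammaFilter, hGdef, Set.indicator_of_mem hs,
        Set.indicator_of_mem h1, Set.indicator_of_mem h2]
      rw [show -a * (x : ℝ) = -a * (x - s) + -a * s by ring, Real.exp_add]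
      change c * ((x - s) ^ n * Real.exp (-a * (x - s))) * (Real.exp (-a * s) * D s /
        (c * n.factorial)) = Real.exp (-a * (x - s)) * Real.exp (-a * s) *
        ((x - s) ^ n / n.factorial * D s)
      clear_value a c D
      field_simp
    · rw [Set.indicator_of_notMem hs]
      by_cases h0 : 0 < s
      · have h2 : (x : ℝ) - s ∉ Set.Ioi (0 : ℝ) := fun h => hs ⟨h0, sub_pos.1 h⟩
        simp [maternFeature, gammaFilter, Set.indicator_of_notMem h2]
      · have h1 : s ∉ Set.Ioc (0 : ℝ) 1 := fun h => h0 h.1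
        simp [hGdef, Set.indicator_of_notMem h1]
  · simp_rw [hG2]
    rw [integral_indicator measurableSet_Ioc]
    calc ∫ s in Set.Ioc 0 1, (Real.exp (-a * s) * D s / (c * n.factorial)) ^ 2
        ≤ ∫ s in Set.Ioc 0 1, D s ^ 2 / (c * n.factorial) ^ 2 := by
          refine setIntegral_mono_on (hint _ (by fun_prop)) (hint _ (by fun_prop))
            measurableSet_Ioc fun s hs => ?_
          rw [div_pow]
          gcongr ?_ / _
          rw [mul_pow]
          refine mul_le_of_le_one_left (sq_nonneg _) (pow_le_one₀ (Real.exp_nonneg _) ?_)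
          exact Real.exp_le_one_iff.2 (by nlinarith [hs.1])
      _ ≤ B ^ 2 := by
          rw [integral_div, div_le_iff₀ (by positivity)]
          refine hB.trans (le_of_eq ?_)
          ring

/-- A smooth bump of height one, supported in `[-1/2, 1/2]`. -/
def unitBump : ContDiffBump (0 : ℝ) := ⟨1 / 4, 1 / 2, by norm_num, by norm_num⟩

/-- The bump of height one and width `1 / b` around `c`. -/
def spike (b c x : ℝ) : ℝ := unitBump (b * (x - c))

lemma contDiff_spike (b c : ℝ) {n : ℕ∞} : ContDiff ℝ n (spike b c) :=
  unitBump.contDiff.comp (by fun_prop)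

lemma spike_self (b c : ℝ) : spike b c c = 1 := by
  rw [spike, sub_self, mul_zero]
  exact unitBump.eventuallyEq_one.eq_of_nhds

lemma spike_nonneg (b c x : ℝ) : 0 ≤ spike b c x := unitBump.nonneg

lemma spike_le_one (b c x : ℝ) : spike b c x ≤ 1 := unitBump.le_one

lemma spike_eq_zero {b c x : ℝ} (h : 1 / 2 ≤ |b * (x - c)|) : spike b c x = 0 :=
  unitBump.zero_of_le_dist (by simpa [unitBump, Real.dist_eq] using h)

lemma spike_eventuallyEq_zero {b c : ℝ} (h : 1 / 2 < b * c) :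
    spike b c =ᶠ[nhds 0] fun _ => 0 := by
  have : Continuous fun x => b * (c - x) := by fun_prop
  have h0 := (this.tendsto 0).eventually_const_lt (show 1 / 2 < b * (c - 0) by rwa [sub_zero])
  filter_upwards [h0] with x hx
  refine spike_eq_zero ?_
  rw [← abs_neg]
  exact le_trans (by linarith) (le_abs_self (-(b * (x - c))))

/-- The scaling of the Sobolev seminorm: a width `1 / b` costs a factor `b ^ (2 n + 1)`. -/
lemma setIntegral_iteratedDeriv_spike_le (n : ℕ) {b : ℝ} (hb : 0 < b) (c : ℝ) :
    ∫ s in Set.Ioc 0 1, iteratedDeriv (n + 1) (spike b c) s ^ 2 ≤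
      b ^ (2 * n + 1) * ∫ s, iteratedDeriv (n + 1) unitBump s ^ 2 := by
  set D := iteratedDeriv (n + 1) unitBump with hD
  have hψ : ContDiff ℝ (n + 1 : ℕ) unitBump := unitBump.contDiff (n := (n + 1 : ℕ))
  have hDc : Continuous D := hψ.continuous_iteratedDeriv (n + 1) le_rfl
  have hDs : HasCompactSupport D := by
    rw [hD, iteratedDeriv_eq_iterate]
    generalize n + 1 = m
    induction m with
    | zero => simpa using unitBump.hasCompactSupport
    | succ m ih => rw [Function.iterate_succ_apply']; exact ih.deriv
  have hDi : Integrable fun s => D s ^ 2 := by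
    refine Continuous.integrable_of_hasCompactSupport (by fun_prop) ?_
    exact hDs.comp_left (g := fun y : ℝ => y ^ 2) (by simp)
  have hder : ∀ s, iteratedDeriv (n + 1) (spike b c) s = b ^ (n + 1) * D (b * (s - c)) := by
    intro s
    have h1 := iteratedDeriv_comp_sub_const (n + 1) (fun y => unitBump (b * y)) c
    have h2 := iteratedDeriv_comp_const_mul hψ b
    have h3 := congrFun h1 s
    rw [h2] at h3
    exact h3
  have hi : Integrable fun s => D (b * (s - c)) ^ 2 :=
    (hDi.comp_mul_left' hb.ne').comp_sub_right c
  simp_rw [hder, mul_pow]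
  rw [integral_const_mul]
  have h4 : ∫ s, D (b * (s - c)) ^ 2 = b⁻¹ * ∫ s, D s ^ 2 := by
    rw [integral_sub_right_eq_self (fun s => D (b * s) ^ 2) c,
      Measure.integral_comp_mul_left (fun s => D s ^ 2) b, abs_of_pos (inv_pos.2 hb), smul_eq_mul]
  calc (b ^ (n + 1)) ^ 2 * ∫ s in Set.Ioc 0 1, D (b * (s - c)) ^ 2
      ≤ (b ^ (n + 1)) ^ 2 * ∫ s, D (b * (s - c)) ^ 2 := by
        refine mul_le_mul_of_nonneg_left ?_ (by positivity)
        exact setIntegral_le_integral hi (Eventually.of_forall fun s => sq_nonneg _)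
    _ = b ^ (2 * n + 1) * ∫ s, D s ^ 2 := by
        rw [h4, show (b ^ (n + 1)) ^ 2 = b ^ (2 * n + 1) * b by ring]; field_simp

/-- A wide bump of height `ρ` in the left half of `[0, 1]`. -/
def baseReward (ρ : ℝ) : C(unitInterval, ℝ) where
  toFun x := ρ * spike 4 (1 / 4) x
  continuous_toFun := by
    have := (contDiff_spike 4 (1 / 4) (n := 0)).continuous
    fun_prop

/-- The base reward with an additional bump of width `1 / b` around `c`, whose height is between `η`
and `η exp a`. The factor `exp (a (1 - x))` adapts the bump to the filter. -/
def spikedReward (a ρ η b c : ℝ) : C(unitInterval, ℝ) where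
  toFun x := ρ * spike 4 (1 / 4) x + η * Real.exp (a * (1 - x)) * spike b c x
  continuous_toFun := by
    have := (contDiff_spike 4 (1 / 4) (n := 0)).continuous
    have := (contDiff_spike b c (n := 0)).continuous
    fun_prop

lemma baseReward_apply (ρ : ℝ) (x : unitInterval) : baseReward ρ x = ρ * spike 4 (1 / 4) x := rfl

lemma spikedReward_apply (a ρ η b c : ℝ) (x : unitInterval) : spikedReward a ρ η b c x =
    ρ * spike 4 (1 / 4) x + η * Real.exp (a * (1 - x)) * spike b c x := rfl

/-- Spikes of width `1 / b` and height of order `b ^ (-ν)` stay in the Matérn ball. -/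
lemma exists_spikedReward_mem (n : ℕ) {l : ℝ} (hl : 0 < l) :
    ∃ σ : ℝ, 0 < σ ∧ ∀ ρ η b c : ℝ, η ^ 2 ≤ (2 * ρ) ^ 2 → 1 ≤ b → 1 / 2 < b * c →
      ρ ^ 2 * b ^ (2 * n + 1) ≤ σ →
        spikedReward (√(2 * (n + 1 / 2)) / l) ρ η b c ∈ maternBall (n + 1 / 2) l 1 := by
  set a := √(2 * ((n : ℝ) + 1 / 2)) / l with ha_def
  have ha : 0 < a := div_pos (Real.sqrt_pos.2 (by positivity)) hl
  have hc := filterNorm_pos n ha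
  set κ := filterNorm n a * n.factorial * 1 with hκ
  have hκ0 : 0 < κ := by positivity
  set w₀ : ℝ → ℝ := fun x => Real.exp (a * x) * spike 4 (1 / 4) x with hw₀
  set S₀ := ∫ s in Set.Ioc 0 1, iteratedDeriv (n + 1) w₀ s ^ 2 with hS₀
  set S := ∫ s, iteratedDeriv (n + 1) unitBump s ^ 2 with hS
  have hS₀0 : 0 ≤ S₀ := integral_nonneg fun s => sq_nonneg _
  have hS0 : 0 ≤ S := integral_nonneg fun s => sq_nonneg _
  have hw₀c : ContDiff ℝ (n + 1 : ℕ) w₀ :=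
    (Real.contDiff_exp.comp (by fun_prop)).mul (contDiff_spike _ _ (n := (n + 1 : ℕ)))
  -- The summand `1` only serves to make `R` positive.
  set R := 2 * S₀ + 8 * Real.exp a ^ 2 * S + 1 with hR
  have hR0 : 0 < R := by positivity
  refine ⟨κ ^ 2 / R, by positivity, fun ρ η b c hη hb hbc hρ => ?_⟩
  have hb0 : 0 < b := by linarith
  have hsc : ContDiff ℝ (n + 1 : ℕ) (spike b c) := contDiff_spike _ _ (n := (n + 1 : ℕ))
  set A := η * Real.exp a with hA
  refine mem_maternBall_of_contDiff n hl (w := fun x => ρ * w₀ x + A * spike b c x)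
    ((contDiff_const.mul hw₀c).add (contDiff_const.mul hsc)) ?_ (fun x => ?_) zero_le_one ?_
  · filter_upwards [spike_eventuallyEq_zero hbc, spike_eventuallyEq_zero
      (show (1 : ℝ) / 2 < 4 * (1 / 4) by norm_num)] with x h1 h2
    simp only [hw₀, h1, h2, mul_zero, add_zero]
  · rw [spikedReward_apply]
    simp only [hw₀, hA]
    rw [show a * (1 - (x : ℝ)) = a + -a * x by ring, Real.exp_add]
    have : Real.exp (-a * x) * Real.exp (a * x) = 1 := by rw [← Real.exp_add]; simp
    linear_combination -(ρ * spike 4 (1 / 4) x) * this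
  · have hder : ∀ s, iteratedDeriv (n + 1) (fun x => ρ * w₀ x + A * spike b c x) s =
        ρ * iteratedDeriv (n + 1) w₀ s + A * iteratedDeriv (n + 1) (spike b c) s := by
      intro s
      rw [iteratedDeriv_fun_add (contDiff_const.mul hw₀c).contDiffAt
        (contDiff_const.mul hsc).contDiffAt, iteratedDeriv_const_mul_field,
        iteratedDeriv_const_mul_field]
    have h1c : Continuous (iteratedDeriv (n + 1) w₀) := hw₀c.continuous_iteratedDeriv _ le_rfl
    have h2c : Continuous (iteratedDeriv (n + 1) (spike b c)) :=
      hsc.continuous_iteratedDeriv _ le_rfl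
    have hint : ∀ g : ℝ → ℝ, Continuous g → IntegrableOn g (Set.Ioc 0 1) := fun g hg =>
      (hg.continuousOn.integrableOn_compact isCompact_Icc).mono_set Set.Ioc_subset_Icc_self
    simp_rw [hder]
    calc ∫ s in Set.Ioc 0 1, (ρ * iteratedDeriv (n + 1) w₀ s +
          A * iteratedDeriv (n + 1) (spike b c) s) ^ 2
        ≤ ∫ s in Set.Ioc 0 1, (2 * ρ ^ 2 * iteratedDeriv (n + 1) w₀ s ^ 2 +
          2 * A ^ 2 * iteratedDeriv (n + 1) (spike b c) s ^ 2) := by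
          refine setIntegral_mono_on (hint _ (by fun_prop)) (hint _ (by fun_prop))
            measurableSet_Ioc fun s _ => ?_
          nlinarith [sq_nonneg (ρ * iteratedDeriv (n + 1) w₀ s -
            A * iteratedDeriv (n + 1) (spike b c) s)]
      _ = 2 * ρ ^ 2 * S₀ +
          2 * A ^ 2 * ∫ s in Set.Ioc 0 1, iteratedDeriv (n + 1) (spike b c) s ^ 2 := by
          rw [integral_add (hint _ (by fun_prop)) (hint _ (by fun_prop)), integral_const_mul,
            integral_const_mul]
      _ ≤ 2 * ρ ^ 2 * S₀ + 2 * A ^ 2 * (b ^ (2 * n + 1) * S) := by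
          gcongr
          exact setIntegral_iteratedDeriv_spike_le n hb0 c
      _ ≤ 2 * (ρ ^ 2 * b ^ (2 * n + 1)) * S₀ + 2 * A ^ 2 * (b ^ (2 * n + 1) * S) := by
          gcongr
          exact le_mul_of_one_le_right (sq_nonneg _) (one_le_pow₀ hb)
      _ = 2 * (ρ ^ 2 * b ^ (2 * n + 1)) * S₀ +
          2 * (η ^ 2 * Real.exp a ^ 2) * (b ^ (2 * n + 1) * S) := by
          rw [hA, mul_pow]
      _ ≤ 2 * (ρ ^ 2 * b ^ (2 * n + 1)) * S₀ +
          2 * ((2 * ρ) ^ 2 * Real.exp a ^ 2) * (b ^ (2 * n + 1) * S) := by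
          gcongr
      _ = ρ ^ 2 * b ^ (2 * n + 1) * (2 * S₀ + 8 * Real.exp a ^ 2 * S) := by
          ring
      _ ≤ κ ^ 2 / R * R := by
          gcongr
          linarith
      _ = κ ^ 2 := div_mul_cancel₀ _ hR0.ne'

lemma exists_baseReward_mem (n : ℕ) {l : ℝ} (hl : 0 < l) :
    ∃ σ : ℝ, 0 < σ ∧ ∀ ρ : ℝ, ρ ^ 2 ≤ σ → baseReward ρ ∈ maternBall (n + 1 / 2) l 1 := by
  obtain ⟨σ, hσ, h⟩ := exists_spikedReward_mem n hl
  refine ⟨σ, hσ, fun ρ hρ => ?_⟩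
  have := h ρ 0 1 1 (by rw [zero_pow two_ne_zero]; positivity) le_rfl (by norm_num)
    (by simpa using hρ)
  rwa [show spikedReward (√(2 * (n + 1 / 2)) / l) ρ 0 1 1 = baseReward ρ by
    ext x; simp [baseReward_apply, spikedReward_apply]] at this

/-! ### The trade-off between two Matérn balls -/

lemma le_iSup_continuousMap (f : C(unitInterval, ℝ)) (x : unitInterval) : f x ≤ ⨆ y, f y :=
  le_ciSup (isCompact_range f.continuous).bddAbove x

/-- The center of the bin of index `i`, when the right half of `[0, 1]` is cut into `K` bins. -/
def binCenter (K : ℕ) (i : Fin K) : ℝ := 1 / 2 + (i + 1 / 2) / (2 * K)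

/-- The bin of index `i`, when the right half of `[0, 1]` is cut into `K` bins. -/
def bin (K : ℕ) (i : Fin K) : Set unitInterval :=
  {x | ⌊2 * K * ((x : ℝ) - 1 / 2)⌋ = (i : ℤ)}

lemma measurableSet_bin (K : ℕ) (i : Fin K) : MeasurableSet (bin K i) := by
  have : Measurable fun x : unitInterval => ⌊2 * K * ((x : ℝ) - 1 / 2)⌋ :=
    Int.measurable_floor.comp (by fun_prop)
  exact this (measurableSet_singleton (i : ℤ))

lemma pairwise_disjoint_bin (K : ℕ) : Pairwise (Function.onFun Disjoint (bin K)) := by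
  intro i j hij
  refine Set.disjoint_left.2 fun x hi hj => hij (Fin.ext ?_)
  exact_mod_cast (hi : _ = (i : ℤ)).symm.trans hj

lemma half_le_of_mem_bin {K : ℕ} {i : Fin K} {x : unitInterval} (hx : x ∈ bin K i) :
    1 / 2 ≤ (x : ℝ) := by
  have hK : (0 : ℝ) < K := by exact_mod_cast i.pos
  have h1 : (0 : ℤ) ≤ ⌊2 * K * ((x : ℝ) - 1 / 2)⌋ := by
    rw [show ⌊2 * K * ((x : ℝ) - 1 / 2)⌋ = (i : ℤ) from hx]; positivity
  have h2 := Int.floor_nonneg.1 h1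
  by_contra! h
  nlinarith

lemma spike_eq_zero_of_notMem_bin {K : ℕ} {i : Fin K} {x : unitInterval} (hx : x ∉ bin K i) :
    spike (2 * K) (binCenter K i) x = 0 := by
  have hK : (0 : ℝ) < K := by exact_mod_cast i.pos
  refine spike_eq_zero ?_
  by_contra! h
  refine hx (Int.floor_eq_iff.2 ?_)
  have h1 : 2 * K * ((x : ℝ) - binCenter K i) = 2 * K * ((x : ℝ) - 1 / 2) - (i + 1 / 2) := by
    rw [binCenter]; field_simp; ring
  rw [h1, abs_lt] at h
  push_cast
  constructor <;> linarith [h.1, h.2]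

lemma binCenter_mem (K : ℕ) (i : Fin K) : binCenter K i ∈ unitInterval := by
  have hK : (0 : ℝ) < K := by exact_mod_cast i.pos
  have hi : (i : ℝ) + 1 ≤ K := by exact_mod_cast i.2
  constructor
  · rw [binCenter]; positivity
  · have : ((i : ℝ) + 1 / 2) / (2 * K) ≤ 1 / 2 := by
      rw [div_le_div_iff₀ (by positivity) two_pos]; linarith
    rw [binCenter]; linarith

/-- Low regret on the smooth ball forces high regret on the rough ball: the trade-off at a fixed
horizon, with `K` bins and height `ρ`. -/
lemma exists_mem_maternBall_regret_ge (n₁ n₂ : ℕ) {l₁ l₂ : ℝ} (hl₁ : 0 < l₁) (hl₂ : 0 < l₂) :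
    ∃ σ c : ℝ, 0 < σ ∧ 0 < c ∧ ∀ (π : Policy) (T K : ℕ) (ρ r : ℝ), 0 < K → 0 < ρ →
      ρ ^ 2 * (K : ℝ) ^ (2 * n₁ + 1) ≤ σ → 4 * r * ρ ≤ K → 2 ≤ T * ρ ^ 2 →
      (∀ f ∈ maternBall (n₂ + 1 / 2) l₂ 1,
        expectedRegret (gaussianReal 0 (1 / 4)) f π T ≤ ENNReal.ofReal r) →
      ∃ f ∈ maternBall (n₁ + 1 / 2) l₁ 1,
        ENNReal.ofReal (c * (ρ * T)) ≤ expectedRegret (gaussianReal 0 (1 / 4)) f π T := by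
  obtain ⟨σ₁, hσ₁, h₁⟩ := exists_spikedReward_mem n₁ hl₁
  obtain ⟨σ₂, hσ₂, h₂⟩ := exists_baseReward_mem n₂ hl₂
  set a := √(2 * ((n₁ : ℝ) + 1 / 2)) / l₁ with ha_def
  have ha : 0 ≤ a := by positivity
  set M := 2 * Real.exp a with hM
  refine ⟨min (σ₁ / 2 ^ (2 * n₁ + 1)) σ₂, Real.exp (-4 * M ^ 2) / 4, by positivity, by positivity,
    fun π T K ρ r hK hρ hσ hrK hT hr => ?_⟩
  have hK1 : (1 : ℝ) ≤ K := by exact_mod_cast hK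
  have hbase : baseReward ρ ∈ maternBall (n₂ + 1 / 2) l₂ 1 := by
    refine h₂ ρ (le_trans ?_ (hσ.trans (min_le_right _ _)))
    exact le_mul_of_one_le_right (sq_nonneg _) (one_le_pow₀ hK1)
  have hspike4 : ∀ x : unitInterval, 1 / 2 ≤ (x : ℝ) → spike 4 (1 / 4) x = 0 := fun x hx =>
    spike_eq_zero (le_trans (by linarith) (le_abs_self (4 * ((x : ℝ) - 1 / 4))))
  obtain ⟨i, hi⟩ := exists_expectedRegret_ge π T (baseReward ρ)
    (fun i : Fin K => spikedReward a ρ (2 * ρ) (2 * K) (binCenter K i)) (bin K)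
    (measurableSet_bin K) (pairwise_disjoint_bin K) (ρ := ρ) (M := M) (r := r) hρ
    (fun i x hx => by
      have h := le_iSup_continuousMap (baseReward ρ) ⟨1 / 4, by norm_num, by norm_num⟩
      rw [baseReward_apply, spike_self, mul_one] at h
      rw [baseReward_apply ρ x, hspike4 x (half_le_of_mem_bin hx)]
      linarith)
    (fun i x hx => by
      have hc := binCenter_mem K i
      have h := le_iSup_continuousMap (spikedReward a ρ (2 * ρ) (2 * K) (binCenter K i))
        ⟨binCenter K i, hc⟩
      refine le_trans ?_ h
      rw [spikedReward_apply, spikedReward_apply, spike_eq_zero_of_notMem_bin hx, spike_self]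
      have h1 : 1 ≤ Real.exp (a * (1 - binCenter K i)) :=
        Real.one_le_exp (mul_nonneg ha (sub_nonneg.2 hc.2))
      have h2 := spike_le_one 4 (1 / 4) x
      have h3 := spike_nonneg 4 (1 / 4) (binCenter K i)
      nlinarith [mul_nonneg hρ.le h3])
    (fun i x hx => by
      rw [spikedReward_apply, spike_eq_zero_of_notMem_bin hx, baseReward_apply, mul_zero, add_zero])
    (fun i x => by
      rw [spikedReward_apply, baseReward_apply, add_sub_cancel_left]
      have h1 := spike_nonneg (2 * K) (binCenter K i) x
      have h2 := spike_le_one (2 * K) (binCenter K i) x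
      have h3 : Real.exp (a * (1 - x)) ≤ Real.exp a :=
        Real.exp_le_exp.2 (mul_le_of_le_one_right ha (by linarith [x.2.1]))
      rw [abs_of_nonneg (by positivity), hM]
      calc 2 * ρ * Real.exp (a * (1 - x)) * spike (2 * K) (binCenter K i) x
          ≤ 2 * ρ * Real.exp a * 1 := by gcongr
        _ = 2 * Real.exp a * ρ := by ring)
    hK (hr _ hbase) hrK hT
  refine ⟨_, h₁ ρ (2 * ρ) (2 * K) (binCenter K i) le_rfl (by linarith) ?_ ?_, hi⟩
  · have h1 : 0 ≤ ((i : ℝ) + 1 / 2) / (2 * K) := by positivity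
    have h2 : 2 * K * binCenter K i = K + (i + 1 / 2) := by
      rw [binCenter]; field_simp
    rw [h2]
    have : (0 : ℝ) ≤ i := by positivity
    linarith
  · have := hσ.trans (min_le_left _ _)
    rw [le_div_iff₀ (by positivity)] at this
    rw [mul_pow]
    linarith

/-! ### Asymptotics -/

/-- The choice of the number of bins and of the height of the spikes as functions of the bound `r`
on the regret: `K ≈ r ^ (1 / (ν + 1))` and `ρ ≈ K ^ (-ν)`. -/
lemma exists_bins_and_height (n : ℕ) {σ : ℝ} (hσ : 0 < σ) :
    ∃ s : ℝ, 0 < s ∧ ∀ r : ℝ, 1 ≤ r → ∃ (K : ℕ) (ρ : ℝ), 0 < K ∧ 0 < ρ ∧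
      ρ ^ 2 * (K : ℝ) ^ (2 * n + 1) ≤ σ ∧ 4 * r * ρ ≤ K ∧
      s * r ^ (-(((n : ℝ) + 1 / 2) / (n + 1 / 2 + 1))) ≤ ρ := by
  set ν : ℝ := n + 1 / 2 with hν
  have hν0 : 0 < ν := by positivity
  set s₀ := min (√σ) (1 / 4) with hs₀
  have hs₀0 : 0 < s₀ := lt_min (Real.sqrt_pos.2 hσ) (by norm_num)
  refine ⟨s₀ * 2 ^ (-ν), by positivity, fun r hr => ?_⟩
  have hr0 : 0 < r := by linarith
  set X := r ^ (1 / (ν + 1)) with hX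
  have hX1 : 1 ≤ X := Real.one_le_rpow hr (by positivity)
  set K := ⌈X⌉₊ with hK
  have hKX : X ≤ K := Nat.le_ceil X
  have hK1 : (1 : ℝ) ≤ K := hX1.trans hKX
  have hK0 : (0 : ℝ) < K := by linarith
  have hK2 : (K : ℝ) ≤ 2 * X := by
    have := (Nat.ceil_lt_add_one (show 0 ≤ X by linarith)).le
    linarith
  refine ⟨K, s₀ * (K : ℝ) ^ (-ν), by exact_mod_cast hK0, by positivity, ?_, ?_, ?_⟩
  · have h1 : ((K : ℝ) ^ (-ν)) ^ 2 * (K : ℝ) ^ (2 * n + 1) = 1 := by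
      rw [← Real.rpow_natCast, ← Real.rpow_natCast, ← Real.rpow_mul hK0.le, ← Real.rpow_add hK0,
        hν]
      push_cast
      rw [show -((n : ℝ) + 1 / 2) * 2 + (2 * n + 1) = 0 by ring, Real.rpow_zero]
    rw [mul_pow, mul_assoc, h1, mul_one, ← Real.sq_sqrt hσ.le]
    exact pow_le_pow_left₀ hs₀0.le (min_le_left _ _) 2
  · have h1 : r ≤ (K : ℝ) ^ (ν + 1) := by
      calc r = X ^ (ν + 1) := by
            rw [hX, ← Real.rpow_mul hr0.le, one_div_mul_cancel (by positivity), Real.rpow_one]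
        _ ≤ _ := Real.rpow_le_rpow (by linarith) hKX (by positivity)
    have h2 : s₀ ≤ 1 / 4 := min_le_right _ _
    calc 4 * r * (s₀ * (K : ℝ) ^ (-ν)) ≤ 4 * (K : ℝ) ^ (ν + 1) * (1 / 4 * (K : ℝ) ^ (-ν)) := by
          gcongr
      _ = (K : ℝ) ^ (ν + 1) * (K : ℝ) ^ (-ν) := by ring
      _ = K := by rw [← Real.rpow_add hK0, show ν + 1 + -ν = 1 by ring, Real.rpow_one]
  · have h1 : (2 * X) ^ (-ν) ≤ (K : ℝ) ^ (-ν) :=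
      Real.rpow_le_rpow_of_nonpos hK0 hK2 (by linarith)
    have h2 : X ^ (-ν) = r ^ (-(ν / (ν + 1))) := by
      rw [hX, ← Real.rpow_mul hr0.le]; congr 1; field_simp
    rw [Real.mul_rpow two_pos.le (by linarith), h2] at h1
    calc s₀ * 2 ^ (-ν) * r ^ (-(ν / (ν + 1))) = s₀ * (2 ^ (-ν) * r ^ (-(ν / (ν + 1)))) := by ring
      _ ≤ _ := by gcongr

lemma eventually_log_pow_le (ε : ℝ) (hε : 0 < ε) (k : ℕ) (c : ℝ) (hc : 0 < c) :
    ∀ᶠ T : ℕ in atTop, Real.log T ^ k ≤ c * (T : ℝ) ^ ε := by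
  have h := (isLittleO_log_rpow_rpow_atTop (k : ℝ) hε).bound hc
  filter_upwards [tendsto_natCast_atTop_atTop.eventually h, eventually_ge_atTop 1] with T hT hT1
  have h1 : (1 : ℝ) ≤ T := by exact_mod_cast hT1
  rw [Real.rpow_natCast, Real.norm_of_nonneg (pow_nonneg (Real.log_nonneg h1) _),
    Real.norm_of_nonneg (by positivity)] at hT
  exact hT

lemma eventually_one_lt_log : ∀ᶠ T : ℕ in atTop, 1 < Real.log T :=
  (Real.tendsto_log_atTop.comp tendsto_natCast_atTop_atTop).eventually_gt_atTop 1

lemma not_isTildeO_of_isTildeOmega {g : ℕ → ℝ≥0∞} {a b : ℝ} (hab : a < b)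
    (hg : IsTildeOmega g b) : ¬ IsTildeO g a := by
  rintro ⟨C, k, hC⟩
  obtain ⟨c, j, hc, hj⟩ := hg
  have hC1 : 0 < max C 1 := by positivity
  obtain ⟨T, hT, hT', hlog, hpow, hT0⟩ := (hC.and (hj.and (eventually_one_lt_log.and
    ((eventually_log_pow_le (b - a) (sub_pos.2 hab) (k + j + 1) (c / max C 1)
      (by positivity)).and (eventually_gt_atTop 0))))).exists
  have hTr : (0 : ℝ) < T := by exact_mod_cast hT0
  set L := Real.log T
  have hL0 : 0 < L := by linarith
  have h1 := hT'.trans hT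
  have hTa : (0 : ℝ) < (T : ℝ) ^ a := by positivity
  have h2 : C * (T : ℝ) ^ a * L ^ k ≤ max C 1 * (T : ℝ) ^ a * L ^ k := by
    gcongr; exact le_max_left _ _
  rw [ENNReal.ofReal_le_ofReal_iff'] at h1
  have h3 : 0 < c * (T : ℝ) ^ b / L ^ j := by positivity
  rcases h1 with h1 | h1
  · have h4 := h1.trans h2
    rw [div_le_iff₀ (by positivity), show b = (b - a) + a by ring, Real.rpow_add hTr] at h4
    have h5 : c * (T : ℝ) ^ (b - a) ≤ max C 1 * L ^ (k + j) := by
      refine le_of_mul_le_mul_right ((le_of_eq ?_).trans (h4.trans (le_of_eq ?_))) hTa <;> ring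
    rw [div_mul_eq_mul_div, le_div_iff₀ hC1] at hpow
    have h6 : max C 1 * L ^ (k + j) * L ≤ max C 1 * L ^ (k + j) * 1 := by
      rw [mul_one]
      refine le_trans (le_of_eq ?_) (hpow.trans h5)
      ring
    exact absurd (le_of_mul_le_mul_left h6 (by positivity)) (not_le.2 hlog)
  · linarith

/-- An upper bound `Õ(T ^ a)` on the smooth ball forces a lower bound on the rough ball: with the
regret bound as `r`, the spikes have height of order `r ^ (-ν₁ / (ν₁ + 1))`, up to logarithms, and
missing them costs this height in a constant fraction of the rounds. The condition on `a` says that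
the `ρ ^ (-2)` visits it takes to detect a spike of height `ρ` are few among the `T` rounds. -/
lemma isTildeOmega_worstRegret (n₁ n₂ : ℕ) {l₁ l₂ : ℝ} (hl₁ : 0 < l₁) (hl₂ : 0 < l₂)
    {𝒩 : Set (Measure ℝ)} (h𝒩 : gaussianReal 0 (1 / 4) ∈ 𝒩) {A : Algorithm} {a : ℝ} (ha0 : 0 ≤ a)
    (ha : 2 * (a * (((n₁ : ℝ) + 1 / 2) / (n₁ + 1 / 2 + 1))) < 1)
    (hA : IsTildeO (worstRegret 𝒩 (maternBall (n₂ + 1 / 2) l₂ 1) A) a) :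
    IsTildeOmega (worstRegret 𝒩 (maternBall (n₁ + 1 / 2) l₁ 1) A)
      (1 - a * (((n₁ : ℝ) + 1 / 2) / (n₁ + 1 / 2 + 1))) := by
  obtain ⟨σ, c, hσ, hc, hmain⟩ := exists_mem_maternBall_regret_ge n₁ n₂ hl₁ hl₂
  obtain ⟨s, hs, hchoice⟩ := exists_bins_and_height n₁ hσ
  set θ := ((n₁ : ℝ) + 1 / 2) / (n₁ + 1 / 2 + 1) with hθ
  have hθ0 : 0 ≤ θ := by positivity
  have hθ1 : θ ≤ 1 := (div_le_one (by positivity)).2 (by linarith)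
  obtain ⟨C, k, hC⟩ := hA
  have hC1 : 1 ≤ max C 1 := le_max_right _ _
  set C' := max C 1
  set q := s * C' ^ (-θ) with hq
  have hq0 : 0 < q := by positivity
  refine ⟨c * q, k, by positivity, ?_⟩
  filter_upwards [hC, eventually_one_lt_log, eventually_ge_atTop 1,
    eventually_log_pow_le (1 - 2 * (a * θ)) (by linarith) (2 * k) (q ^ 2 / 2) (by positivity)]
    with T hT hlog hT1 hpow
  have hTr : (1 : ℝ) ≤ T := by exact_mod_cast hT1
  have hT0 : (0 : ℝ) < T := by linarith
  set L := Real.log T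
  have hL0 : 0 < L := by linarith
  set r := C' * (T : ℝ) ^ a * L ^ k with hr
  have hr1 : 1 ≤ r := one_le_mul_of_one_le_of_one_le
    (one_le_mul_of_one_le_of_one_le hC1 (Real.one_le_rpow hTr ha0)) (one_le_pow₀ hlog.le)
  obtain ⟨K, ρ, hK, hρ, hσρ, hrK, hsρ⟩ := hchoice r hr1
  have hρq : q * (T : ℝ) ^ (-(a * θ)) / L ^ k ≤ ρ := by
    refine le_trans ?_ hsρ
    have h1 : (L ^ k) ^ (-θ) ≥ (L ^ k)⁻¹ := by
      rw [← Real.rpow_neg_one]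
      exact Real.rpow_le_rpow_of_exponent_le (one_le_pow₀ hlog.le) (by linarith)
    have h2 : r ^ (-θ) = C' ^ (-θ) * (T : ℝ) ^ (-(a * θ)) * (L ^ k) ^ (-θ) := by
      rw [hr, Real.mul_rpow (by positivity) (by positivity),
        Real.mul_rpow (by positivity) (by positivity), ← Real.rpow_mul hT0.le, mul_neg]
    rw [h2, hq, div_eq_mul_inv]
    calc s * C' ^ (-θ) * (T : ℝ) ^ (-(a * θ)) * (L ^ k)⁻¹
        ≤ s * C' ^ (-θ) * (T : ℝ) ^ (-(a * θ)) * (L ^ k) ^ (-θ) := by gcongr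
      _ = _ := by ring
  have hT2 : 2 ≤ T * ρ ^ 2 := by
    calc (2 : ℝ) ≤ q ^ 2 * (T : ℝ) ^ (1 - 2 * (a * θ)) / L ^ (2 * k) := by
          rw [le_div_iff₀ (by positivity)]; linarith
      _ = T * (q * (T : ℝ) ^ (-(a * θ)) / L ^ k) ^ 2 := by
          rw [show 1 - 2 * (a * θ) = 1 + (-(a * θ) + -(a * θ)) by ring, Real.rpow_add hT0,
            Real.rpow_add hT0, Real.rpow_one]
          ring
      _ ≤ T * ρ ^ 2 := by gcongr
  obtain ⟨f, hf, hfT⟩ := hmain (A T) T K ρ r hK hρ hσρ hrK hT2 fun f hf => by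
    refine le_trans ?_ (hT.trans (ENNReal.ofReal_le_ofReal ?_))
    · exact (le_iSup₂ (f := fun N (_ : N ∈ 𝒩) => expectedRegret N f (A T) T) _ h𝒩).trans
        (le_iSup₂ (f := fun f (_ : f ∈ maternBall (n₂ + 1 / 2) l₂ 1) =>
          ⨆ N ∈ 𝒩, expectedRegret N f (A T) T) f hf)
    · rw [hr]; gcongr; exact le_max_left _ _
  refine le_trans (ENNReal.ofReal_le_ofReal ?_) (hfT.trans ?_)
  · calc c * q * (T : ℝ) ^ (1 - a * θ) / L ^ k
        = c * (q * (T : ℝ) ^ (-(a * θ)) / L ^ k * T) := by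
          rw [show 1 - a * θ = -(a * θ) + 1 by ring, Real.rpow_add hT0, Real.rpow_one]; ring
      _ ≤ c * (ρ * T) := by gcongr
  · exact (le_iSup₂ (f := fun N (_ : N ∈ 𝒩) => expectedRegret N f (A T) T) _ h𝒩).trans
      (le_iSup₂ (f := fun f (_ : f ∈ maternBall (n₁ + 1 / 2) l₁ 1) =>
        ⨆ N ∈ 𝒩, expectedRegret N f (A T) T) f hf)

lemma exists_eq_natCast_add_half {ν : ℝ} (hν : 0 < ν) (hm : ∃ m : ℕ, ν + 1 / 2 = m) :
    ∃ n : ℕ, ν = n + 1 / 2 := by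
  obtain ⟨m, hm⟩ := hm
  have hm0 : m ≠ 0 := by
    rintro rfl
    rw [Nat.cast_zero] at hm
    linarith
  obtain ⟨n, rfl⟩ := Nat.exists_eq_succ_of_ne_zero hm0
  refine ⟨n, ?_⟩
  push_cast at hm
  linarith

end

theorem corollary1 (ν₁ ν₂ : ℝ) (hν₁ : 0 < ν₁) (hν : ν₁ < ν₂)
    (hm₁ : ∃ m₁ : ℕ, ν₁ + 1 / 2 = m₁) (hm₂ : ∃ m₂ : ℕ, ν₂ + 1 / 2 = m₂)
    (l₁ l₂ : ℝ) (hl₁ : 0 < l₁) (hl₂ : 0 < l₂) :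
    (ν₁ + 1) / (2 * ν₁ + 1) < (ν₁ * ν₂ + 2 * ν₂ + 1) / ((ν₁ + 1) * (2 * ν₂ + 1)) ∧
    ∃ B₁ B₂ : ℝ, 0 < B₁ ∧ 0 < B₂ ∧
      ∀ 𝒩 : Set (Measure ℝ),
        (∀ N ∈ 𝒩, IsQuarterSubgaussian N) → gaussianReal 0 (1 / 4) ∈ 𝒩 →
        ∀ A : Algorithm,
          IsTildeO (worstRegret 𝒩 (maternBall ν₂ l₂ B₂) A) ((ν₂ + 1) / (2 * ν₂ + 1)) →
            IsTildeOmega (worstRegret 𝒩 (maternBall ν₁ l₁ B₁) A)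
                ((ν₁ * ν₂ + 2 * ν₂ + 1) / ((ν₁ + 1) * (2 * ν₂ + 1))) ∧
              ¬ IsTildeO (worstRegret 𝒩 (maternBall ν₁ l₁ B₁) A)
                ((ν₁ + 1) / (2 * ν₁ + 1)) := by
  have hν₂ : 0 < ν₂ := hν₁.trans hν
  have hlt : (ν₁ + 1) / (2 * ν₁ + 1) <
      (ν₁ * ν₂ + 2 * ν₂ + 1) / ((ν₁ + 1) * (2 * ν₂ + 1)) := by
    rw [div_lt_div_iff₀ (by positivity) (by positivity)]
    -- the difference of the two sides is `ν₁ * (ν₂ - ν₁)`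
    nlinarith [mul_pos hν₁ (sub_pos.2 hν)]
  refine ⟨hlt, 1, 1, one_pos, one_pos, fun 𝒩 _ h𝒩 A hA => ?_⟩
  have hexp : (ν₁ * ν₂ + 2 * ν₂ + 1) / ((ν₁ + 1) * (2 * ν₂ + 1)) =
      1 - (ν₂ + 1) / (2 * ν₂ + 1) * (ν₁ / (ν₁ + 1)) := by
    field_simp
    ring
  have hsmall : 2 * ((ν₂ + 1) / (2 * ν₂ + 1) * (ν₁ / (ν₁ + 1))) < 1 := by
    rw [div_mul_div_comm, ← mul_div_assoc, div_lt_one (by positivity)]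
    nlinarith
  have ha0 : 0 ≤ (ν₂ + 1) / (2 * ν₂ + 1) := by positivity
  obtain ⟨n₁, rfl⟩ := exists_eq_natCast_add_half hν₁ hm₁
  obtain ⟨n₂, rfl⟩ := exists_eq_natCast_add_half hν₂ hm₂
  have hΩ := isTildeOmega_worstRegret n₁ n₂ hl₁ hl₂ h𝒩 ha0 hsmall hA
  rw [← hexp] at hΩ
  exact ⟨hΩ, not_isTildeO_of_isTildeOmega hlt hΩ⟩
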